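/- Let $\mathbb{C}$ denote an algebraically closed field of characteristic $0$ and let $n,m,N\ge 0$. A double Poisson bracket on a unital algebra $A$ is a linear map $\{\!\{-,-\}\!\}:A\otimes A\to A\otimes A$, written $\{\!\{a,b\}\!\}=\{\!\{a,b\}\!\}'\otimes\{\!\{a,b\}\!\}''$, which satisfies $\{\!\{a,bc\}\!\}=b\{\!\{a,c\}\!\}+\{\!\{a,b\}\!\}c$ for the outer bimodule structure $a.(u\otimes v).b=au\otimes vb$, $\{\!\{a,b\}\!\}=-\{\!\{b,a\}\!\}^{o}$ (where $(u\otimes v)^{o}=v\otimes u$), and the double Jacobi identity $$\{\!\{a,\{\!\{b,c\}\!\}'\}\!\}\otimes\{\!\{b,c\}\!\}''+\{\!\{c,a\}\!\}''\otimes\{\!\{b,\{\!\{c,a\}\!\}'\}\!\}+\{\!\{c,\{\!\{a,b\}\!\}'\}\!\}''\otimes\{\!\{a,b\}\!\}''\otimes\{\!\{c,\{\!\{a,b\}\!\}'\}\!\}'=0 .$$ Let $S=\mathbb{C}^{\oplus n}$ with its orthogonal idempotents $e_1,\dots,e_n$, and let $a_{ij}$ be the double derivation $a_{ij}(s)=e_j\otimes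 e_is-se_j\otimes e_i$ of $S$ (so $e_i.a_{ij}.e_j=a_{ij}$ for the inner bimodule structure $(s.\vartheta.t)(u)=\vartheta(u)'t\otimes s\vartheta(u)''$). The double bracket of a product $\delta\Delta$ of double derivations is $$\{\!\{a,b\}\!\}=\Delta(b)'\delta(a)''\otimes\delta(a)'\Delta(b)''-\delta(b)'\Delta(a)''\otimes\Delta(a)'\delta(b)'',$$ extended linearly, and $P=\sum_{i,j}c_{ij}a_{ij}a_{ji}$ is called a double Poisson tensor if its double bracket is a double Poisson bracket on $S$. Let likewise $T=\mathbb{C}^{\oplus m}$ with orthogonal idempotents $f_1,\dots,f_m$ and double derivations $b_{kl}(t)=f_l\otimes f_kt-tf_l\otimes f_k$. Let $P=\sum_{i,j}c_{ij}a_{ij}a_{ji}$ and $P'=\sum_{k,l}d_{kl}b_{kl}b_{lk}$ be double Poisson tensors on $S$ and $T$. Put $$\bar c_{ij}=c_{ij}-c_{ji},\quad \bar d_{kl}=d_{kl}-d_{lk},\quad \bar e_i=-\sum_{s\ne i}\bar c_{is}e_s,\quad \bar f_k=-\sum_{s\neq k}\bar d_{ks}f_s .$$ Then there is exactly one double Poisson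 bracket on the free product $S*T$ which restricts to the brackets of $P$ on $S$ and of $P'$ on $T$ and satisfies $\{\!\{s,t\}\!\}=0$ for $s\in S$, $t\in T$. It induces a unique Poisson bracket on $\mathbb{C}[\mathsf{rep}_N(S*T)]$ with $\{a_{ij},b_{kl}\}=\{\!\{a,b\}\!\}'_{kj}\{\!\{a,b\}\!\}''_{il}$ for all $a,b\in S*T$, and the latter restricts to a (unique) Poisson bracket on $\mathbb{C}[\mathsf{iss}_N(S*T)]=\mathbb{C}[\mathsf{rep}_N(S*T)]^{\mathsf{GL}_N}$. These brackets are given explicitly as follows. Let $x=e_{i_1}f_{i_1'}\cdots e_{i_p}f_{i_p'}$ and $y=e_{j_1}f_{j_1'}\cdots e_{j_q}f_{j_q'}$. (1) Write $x=x_1\cdots x_{2p}$ and $y=y_1\cdots y_{2q}$ for the letters of $x$ and $y$, and for $u\in S*T$ put $$[u]_{r,s}=y_1\cdots y_{s-1}\bigl(x_r\cdots x_{2p}\otimes x_1\cdots x_{r-1}u-u\,x_{r+1}\cdots x_{2p}\otimes x_1\cdots x_r\bigr)y_{s+1}\cdots y_{2q}.$$ Then $$\{\!\{x,y\}\!\}=\sum_{\ell=1}^p\Bigl(\sum_{k:\,j_k'\ne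 i_\ell'}\bar d_{i_\ell'j_k'}[f_{j_k'}]_{2\ell,2k}+\sum_{k:\,j_k\neq i_\ell}\bar c_{i_\ell j_k}[e_{j_k}]_{2\ell-1,2k-1}+\sum_{k:\,j_k'=i_\ell'}[\bar f_{j_k'}]_{2\ell,2k}+\sum_{k:\,j_k=i_\ell}[\bar e_{j_k}]_{2\ell-1,2k-1}\Bigr).$$ (2) Let $\sigma$ be the cyclic rotation of words, $\sigma(aw)=wa$ for a letter $a$; let $y_k$ be the word $y$ with its letter $f_{j_k'}$ replaced by $\bar f_{j_k'}$, and ${}_ky$ the word $y$ with its letter $e_{j_k}$ replaced by $\bar e_{j_k}$. With $i_{p+1}=i_1$ and $j_{q+1}=j_1$, $$\begin{aligned}\{tr(x),tr(y)\}=\sum_{\ell=1}^p\Bigl[&\,tr\Bigl(\sigma^{2\ell-1}(x)\Bigl(\sum_{k:\,j_k'\ne i_\ell'}\bar d_{i_\ell'j_k'}\sigma^{2k-1}(y)-\sum_{k:\,j_k\ne i_\ell}\bar c_{i_\ell j_k}\sigma^{2k-1}(y)\Bigr)\Bigr)\\ &-tr\Bigl(\sigma^{2\ell}(x)\Bigl(\sum_{k:\,j_k'\ne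 i_\ell'}\bar d_{i_\ell'j_k'}\sigma^{2k}(y)-\sum_{k:\,j_{k+1}\ne i_{\ell+1}}\bar c_{i_{\ell+1}j_{k+1}}\sigma^{2k}(y)\Bigr)\Bigr)\\ &+\sum_{k:\,j_k'=i_\ell'}\Bigl(tr(\sigma^{2\ell-1}(x)\sigma^{2k-1}(y_k))-tr(\sigma^{2\ell}(x)\sigma^{2k}(y_k))\Bigr)\\ &+\sum_{k:\,j_k=i_\ell}\Bigl(tr(\sigma^{2(\ell-1)}(x)\sigma^{2(k-1)}({}_ky))-tr(\sigma^{2\ell-1}(x)\sigma^{2k-1}({}_ky))\Bigr)\Bigr],\end{aligned}$$ where all sums over $k$ run over $1\le k\le q$. -/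

import Mathlib

open scoped TensorProduct BigOperators

noncomputable section

namespace DoublePoisson

/-! ### Double brackets -/

/-- Bilinear maps `A × A → A ⊗ A`. -/
abbrev BilinearToTensor (K A : Type*) [Field K] [Ring A] [Algebra K A] :=
  A →ₗ[K] A →ₗ[K] A ⊗[K] A

/-- The cyclic permutation `x₁ ⊗ x₂ ⊗ x₃ ↦ x₃ ⊗ x₁ ⊗ x₂` of `A ⊗ A ⊗ A`. -/
def cyc (K A : Type*) [Field K] [Ring A] [Algebra K A] :
    (A ⊗[K] A) ⊗[K] A →ₗ[K] (A ⊗[K] A) ⊗[K] A :=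
  (TensorProduct.assoc K A A A).symm.toLinearMap ∘ₗ
    (TensorProduct.comm K (A ⊗[K] A) A).toLinearMap

/-- `⦃a, ⦃b, c⦄'⦄ ⊗ ⦃b, c⦄''` for a bilinear map `D = ⦃-,-⦄`. -/
def nested {K A : Type*} [Field K] [Ring A] [Algebra K A] (D : BilinearToTensor K A)
    (a b c : A) : (A ⊗[K] A) ⊗[K] A :=
  (D a).rTensor A (D b c)

/-- A double Poisson bracket on `A`: a bilinear map `A × A → A ⊗ A` which is a derivation in its
second argument for the outer bimodule structure `x.(u ⊗ v).y = xu ⊗ vy`, satisfies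
`⦃a, b⦄ = -⦃b, a⦄ᵒ`, and satisfies the double Jacobi identity. -/
structure IsDoublePoissonBracket {K A : Type*} [Field K] [Ring A] [Algebra K A]
    (D : BilinearToTensor K A) : Prop where
  derivation : ∀ a b c : A,
    D a (b * c) = (b ⊗ₜ[K] (1 : A)) * D a c + D a b * ((1 : A) ⊗ₜ[K] c)
  antisymm : ∀ a b : A, D a b = -(TensorProduct.comm K A A (D b a))
  jacobi : ∀ a b c : A,
    nested D a b c + cyc K A (nested D b c a) + cyc K A (cyc K A (nested D c a b)) = 0

/-- The inner double derivation `y ↦ t' ⊗ t''y - yt' ⊗ t''` attached to `t = t' ⊗ t''`. -/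
def innerDoubleDer {K A : Type*} [Field K] [Ring A] [Algebra K A] (t : A ⊗[K] A) :
    A →ₗ[K] A ⊗[K] A :=
  LinearMap.mulLeft K t ∘ₗ (Algebra.TensorProduct.includeRight : A →ₐ[K] A ⊗[K] A).toLinearMap -
    LinearMap.mulRight K t ∘ₗ (Algebra.TensorProduct.includeLeft : A →ₐ[K] A ⊗[K] A).toLinearMap

/-- The bilinear map `(u ⊗ v, s ⊗ t) ↦ sv ⊗ ut`. -/
def interlace (K A : Type*) [Field K] [Ring A] [Algebra K A] :
    A ⊗[K] A →ₗ[K] A ⊗[K] A →ₗ[K] A ⊗[K] A :=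
  TensorProduct.map₂ (LinearMap.mul K A).flip (LinearMap.mul K A) ∘ₗ
    (TensorProduct.comm K A A).toLinearMap

/-- The double bracket of the degree two element `δΔ`, for double derivations `δ` and `Δ`:
`⦃a, b⦄ = Δ(b)'δ(a)'' ⊗ δ(a)'Δ(b)'' - δ(b)'Δ(a)'' ⊗ Δ(a)'δ(b)''`. -/
def bracketOfPair {K A : Type*} [Field K] [Ring A] [Algebra K A] (δ Δ : A →ₗ[K] A ⊗[K] A) :
    BilinearToTensor K A :=
  (interlace K A).compl₁₂ δ Δ - (interlace K A).compl₁₂ Δ δ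

/-! ### Double Poisson tensors on `K^n` -/

/-- The arrow `a_{ij} : j → i` of the double derivation quiver of `S = K^n`, as a double
derivation of `S`: the inner double derivation attached to `e_j ⊗ e_i`. For the inner bimodule
structure `(s.ϑ.t)(u) = ϑ(u)'t ⊗ sϑ(u)''` it satisfies `e_i.a_{ij}.e_j = a_{ij}`. -/
def arrow (K : Type*) [Field K] {n : ℕ} (i j : Fin n) :
    (Fin n → K) →ₗ[K] (Fin n → K) ⊗[K] (Fin n → K) :=
  innerDoubleDer ((Pi.single j (1 : K) : Fin n → K) ⊗ₜ[K] (Pi.single i (1 : K) : Fin n → K))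

/-- The double bracket on `K^n` of the degree two element `P = ∑ c_{ij} a_{ij} a_{ji}`. -/
def tensorBracket {K : Type*} [Field K] {n : ℕ} (c : Fin n → Fin n → K) :
    BilinearToTensor K (Fin n → K) :=
  ∑ i, ∑ j, c i j • bracketOfPair (arrow K i j) (arrow K j i)

/-- `P = ∑ c_{ij} a_{ij} a_{ji}` is a double Poisson tensor: its double bracket is Poisson. -/
def IsDoublePoissonTensor {K : Type*} [Field K] {n : ℕ} (c : Fin n → Fin n → K) : Prop :=
  IsDoublePoissonBracket (tensorBracket c)

/-! ### The free product `K^n * K^m` -/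

/-- The free product (coproduct of unital algebras) `K^n * K^m`. -/
abbrev FreeProd (K : Type*) [Field K] (n m : ℕ) :=
  LinearAlgebra.FreeProduct K (fun b : Fin 2 => Fin (![n, m] b) → K)

/-- The canonical map `K^n → K^n * K^m`. -/
def inl (K : Type*) [Field K] (n m : ℕ) : (Fin n → K) →ₐ[K] FreeProd K n m :=
  LinearAlgebra.FreeProduct.ι K (fun b : Fin 2 => Fin (![n, m] b) → K) 0

/-- The canonical map `K^m → K^n * K^m`. -/
def inr (K : Type*) [Field K] (n m : ℕ) : (Fin m → K) →ₐ[K] FreeProd K n m :=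
  LinearAlgebra.FreeProduct.ι K (fun b : Fin 2 => Fin (![n, m] b) → K) 1

/-- The idempotent `e_i` of the first factor. -/
def e (K : Type*) [Field K] {n : ℕ} (m : ℕ) (i : Fin n) : FreeProd K n m :=
  inl K n m (Pi.single i 1)

/-- The idempotent `f_k` of the second factor. -/
def f (K : Type*) [Field K] (n : ℕ) {m : ℕ} (k : Fin m) : FreeProd K n m :=
  inr K n m (Pi.single k 1)

/-- `D` is a double Poisson bracket on `K^n * K^m` induced by the tensors with coefficients `c`
and `d`: it restricts to their brackets on the factors, and the factors bracket to zero. -/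
structure IsInducedDoubleBracket {K : Type*} [Field K] {n m : ℕ} (c : Fin n → Fin n → K)
    (d : Fin m → Fin m → K) (D : BilinearToTensor K (FreeProd K n m)) : Prop where
  poisson : IsDoublePoissonBracket D
  left : ∀ s s' : Fin n → K, D (inl K n m s) (inl K n m s') =
    TensorProduct.map (inl K n m).toLinearMap (inl K n m).toLinearMap (tensorBracket c s s')
  right : ∀ t t' : Fin m → K, D (inr K n m t) (inr K n m t') =
    TensorProduct.map (inr K n m).toLinearMap (inr K n m).toLinearMap (tensorBracket d t t')
  mixed : ∀ (s : Fin n → K) (t : Fin m → K), D (inl K n m s) (inr K n m t) = 0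

/-! ### Representation spaces and their quotients -/

/-- The relations among the coordinate functions `a_{ij}` on `rep_N(A)`. -/
inductive RepRel (K A : Type*) [Field K] [Ring A] [Algebra K A] (N : ℕ) :
    MvPolynomial (A × Fin N × Fin N) K → Prop
  | add (a b : A) (i j : Fin N) : RepRel K A N
      (MvPolynomial.X (a + b, i, j) - (MvPolynomial.X (a, i, j) + MvPolynomial.X (b, i, j)))
  | smul (r : K) (a : A) (i j : Fin N) : RepRel K A N
      (MvPolynomial.X (r • a, i, j) - r • MvPolynomial.X (a, i, j))
  | one (i j : Fin N) : RepRel K A N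
      (MvPolynomial.X (1, i, j) - if i = j then 1 else 0)
  | mul (a b : A) (i j : Fin N) : RepRel K A N
      (MvPolynomial.X (a * b, i, j) -
        ∑ l, MvPolynomial.X (a, i, l) * MvPolynomial.X (b, l, j))

/-- The coordinate ring `K[rep_N(A)]` of the variety of `N`-dimensional representations: it is
generated by the functions `a_{ij}`, with the relations saying that `a ↦ (a_{ij})` is a
homomorphism of unital algebras from `A` to `N × N` matrices. -/
abbrev RepRing (K A : Type*) [Field K] [Ring A] [Algebra K A] (N : ℕ) :=
  MvPolynomial (A × Fin N × Fin N) K ⧸ Ideal.span {p | RepRel K A N p}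

variable {K A : Type*} [Field K] [Ring A] [Algebra K A] {N : ℕ}

theorem mk_eq_of_rel {p q : MvPolynomial (A × Fin N × Fin N) K} (h : RepRel K A N (p - q)) :
    Ideal.Quotient.mkₐ K (Ideal.span {p | RepRel K A N p}) p =
      Ideal.Quotient.mkₐ K (Ideal.span {p | RepRel K A N p}) q :=
  Ideal.Quotient.eq.2 (Ideal.subset_span h)

/-- The coordinate function `a_{ij}`, linear in `a`. -/
def coord (K A : Type*) [Field K] [Ring A] [Algebra K A] {N : ℕ} (i j : Fin N) :
    A →ₗ[K] RepRing K A N where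
  toFun a := Ideal.Quotient.mkₐ K _ (MvPolynomial.X (a, i, j))
  map_add' a b := by rw [mk_eq_of_rel (RepRel.add a b i j), map_add]
  map_smul' r a := by rw [mk_eq_of_rel (RepRel.smul r a i j), map_smul]; rfl

theorem coord_one (i j : Fin N) :
    coord K A i j 1 = if i = j then 1 else 0 := by
  refine (mk_eq_of_rel (RepRel.one i j)).trans ?_
  split_ifs <;> simp

theorem coord_mul (a b : A) (i j : Fin N) :
    coord K A i j (a * b) = ∑ l, coord K A i l a * coord K A l j b := by
  refine (mk_eq_of_rel (RepRel.mul a b i j)).trans ?_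
  simp only [map_sum, map_mul]
  rfl

/-- The universal representation `a ↦ (a_{ij})`. -/
def univRep (K A : Type*) [Field K] [Ring A] [Algebra K A] (N : ℕ) :
    A →ₐ[K] Matrix (Fin N) (Fin N) (RepRing K A N) :=
  AlgHom.ofLinearMap
    { toFun := fun a => Matrix.of fun i j => coord K A i j a
      map_add' := fun a b => by ext i j; simp
      map_smul' := fun r a => by ext i j; simp }
    (by
      ext i j
      simp [coord_one, Matrix.one_apply])
    (fun a b => by
      ext i j
      simp [coord_mul, Matrix.mul_apply])

/-- The homomorphism `K[rep_N(A)] → R` classifying a representation of `A` over `R`. -/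
def repLift {R : Type*} [CommRing R] [Algebra K R] (ρ : A →ₐ[K] Matrix (Fin N) (Fin N) R) :
    RepRing K A N →ₐ[K] R :=
  Ideal.Quotient.liftₐ (Ideal.span {p | RepRel K A N p})
    (MvPolynomial.aeval fun x : A × Fin N × Fin N => ρ x.1 x.2.1 x.2.2)
    (by
      intro p hp
      rw [← RingHom.mem_ker]
      refine (Ideal.span_le (I := RingHom.ker _)).2 ?_ hp
      rintro _ (⟨a, b, i, j⟩ | ⟨r, a, i, j⟩ | ⟨i, j⟩ | ⟨a, b, i, j⟩)
      · simp
      · simp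
      · by_cases h : i = j <;> simp [h]
      · simp [Matrix.mul_apply])

theorem repLift_coord {R : Type*} [CommRing R] [Algebra K R]
    (ρ : A →ₐ[K] Matrix (Fin N) (Fin N) R) (a : A) (i j : Fin N) :
    repLift ρ (coord K A i j a) = ρ a i j := by
  change MvPolynomial.aeval _ (MvPolynomial.X (a, i, j)) = _
  simp

/-- The conjugate `a ↦ g (a_{ij}) g⁻¹` of the universal representation. -/
def conjRep (K A : Type*) [Field K] [Ring A] [Algebra K A] {N : ℕ} (g : GL (Fin N) K) :
    A →ₐ[K] Matrix (Fin N) (Fin N) (RepRing K A N) :=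
  let φ := (Algebra.ofId K (RepRing K A N)).mapMatrix (m := Fin N)
  AlgHom.ofLinearMap
    (LinearMap.mulRight K (φ (g⁻¹ : GL (Fin N) K)) ∘ₗ LinearMap.mulLeft K (φ g) ∘ₗ
      (univRep K A N).toLinearMap)
    (by
      change φ g * univRep K A N 1 * φ (g⁻¹ : GL (Fin N) K) = 1
      rw [map_one, mul_one, ← map_mul, ← Units.val_mul, mul_inv_cancel, Units.val_one, map_one])
    (fun a b => by
      have h : φ (g⁻¹ : GL (Fin N) K) * φ g = 1 := by
        rw [← map_mul, ← Units.val_mul, inv_mul_cancel, Units.val_one, map_one]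
      simp only [LinearMap.comp_apply, LinearMap.mulRight_apply, LinearMap.mulLeft_apply,
        AlgHom.toLinearMap_apply, map_mul, mul_assoc]
      rw [← mul_assoc _ (φ g) _, h, one_mul])

/-- The action of `g ∈ GL_N` on `K[rep_N(A)]` by conjugation. -/
def conj (K A : Type*) [Field K] [Ring A] [Algebra K A] {N : ℕ} (g : GL (Fin N) K) :
    RepRing K A N →ₐ[K] RepRing K A N :=
  repLift (conjRep K A g)

/-- The coordinate ring `K[iss_N(A)] = K[rep_N(A)]^{GL_N}`. -/
def issRing (K A : Type*) [Field K] [Ring A] [Algebra K A] (N : ℕ) :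
    Subalgebra K (RepRing K A N) :=
  ⨅ g : GL (Fin N) K, AlgHom.equalizer (conj K A g) (AlgHom.id K (RepRing K A N))

theorem trace_univRep_mem (a : A) : (univRep K A N a).trace ∈ issRing K A N := by
  simp only [issRing, Algebra.mem_iInf, AlgHom.mem_equalizer, AlgHom.id_apply]
  intro g
  have h1 : conj K A g (univRep K A N a).trace = (conjRep K A g a).trace := by
    simp only [Matrix.trace, map_sum]
    exact Finset.sum_congr rfl fun i _ => repLift_coord _ _ _ _
  rw [h1]
  set φ := (Algebra.ofId K (RepRing K A N)).mapMatrix (m := Fin N)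
  change (φ g * univRep K A N a * φ (g⁻¹ : GL (Fin N) K)).trace = _
  rw [Matrix.trace_mul_comm, ← mul_assoc, ← map_mul, ← Units.val_mul, inv_mul_cancel,
    Units.val_one, map_one, one_mul]

/-- The invariant function `tr(a) = ∑ a_{ii}` on `iss_N(A)`. -/
def tr (K : Type*) {A : Type*} [Field K] [Ring A] [Algebra K A] (N : ℕ) (a : A) :
    issRing K A N :=
  ⟨(univRep K A N a).trace, trace_univRep_mem a⟩

/-- Poisson brackets on a commutative algebra. -/
structure IsPoissonBracket {R : Type*} [CommRing R] [Algebra K R]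
    (B : R →ₗ[K] R →ₗ[K] R) : Prop where
  antisymm : ∀ x y, B x y = -B y x
  leibniz : ∀ x y z, B x (y * z) = y * B x z + B x y * z
  jacobi : ∀ x y z, B x (B y z) + B y (B z x) + B z (B x y) = 0

/-- `B` is the Poisson bracket on `K[rep_N(A)]` induced by `D = ⦃-,-⦄`:
`{a_{ij}, b_{kl}} = ⦃a, b⦄'_{kj} ⦃a, b⦄''_{il}`. -/
structure IsInducedOnRep (D : BilinearToTensor K A)
    (B : RepRing K A N →ₗ[K] RepRing K A N →ₗ[K] RepRing K A N) : Prop where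
  poisson : IsPoissonBracket B
  coord : ∀ (a b : A) (i j k l : Fin N), B (coord K A i j a) (coord K A k l b) =
    TensorProduct.lift ((LinearMap.mul K (RepRing K A N)).compl₁₂ (coord K A k j) (coord K A i l))
      (D a b)

/-- `B'` is a Poisson bracket on `K[iss_N(A)]` that is the restriction of the bracket `B` on
`K[rep_N(A)]`. -/
structure IsRestrictionToIss (B : RepRing K A N →ₗ[K] RepRing K A N →ₗ[K] RepRing K A N)
    (B' : issRing K A N →ₗ[K] issRing K A N →ₗ[K] issRing K A N) : Prop where
  poisson : IsPoissonBracket B'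
  restrict : ∀ x y : issRing K A N, (B' x y : RepRing K A N) = B x y

/-! ### Words and the explicit bracket -/

/-- `c̄_{ij} = c_{ij} - c_{ji}`. -/
def bar {K : Type*} [Field K] {n : ℕ} (c : Fin n → Fin n → K) (i j : Fin n) : K :=
  c i j - c j i

/-- `ē_i = -∑_{s ≠ i} c̄_{is} e_s`. -/
def eBar {K : Type*} [Field K] {n : ℕ} (m : ℕ) (c : Fin n → Fin n → K) (i : Fin n) :
    FreeProd K n m :=
  -∑ s with s ≠ i, bar c i s • e K m s

/-- `f̄_k = -∑_{s ≠ k} d̄_{ks} f_s`. -/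
def fBar {K : Type*} [Field K] (n : ℕ) {m : ℕ} (d : Fin m → Fin m → K) (k : Fin m) :
    FreeProd K n m :=
  -∑ s with s ≠ k, bar d k s • f K n s

/-- The word `e_{i_1} f_{i'_1} ⋯ e_{i_p} f_{i'_p}`, as the list of its `2p` letters. -/
def word (K : Type*) [Field K] {n m p : ℕ} (i : Fin p → Fin n) (i' : Fin p → Fin m) :
    List (FreeProd K n m) :=
  (List.ofFn fun l => [e K m (i l), f K n (i' l)]).flatten

/-- The value in the free product of the `r`-th cyclic rotation `σ^r(w)` of a word `w`,
where `σ(a w) = w a` for a letter `a`. -/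
def rot {A : Type*} [Ring A] (r : ℕ) (w : List A) : A :=
  (w.rotate r).prod

/-- For words `x = x_0 x_1 ⋯` and `y = y_0 y_1 ⋯`, positions `a` and `b`, and `u ∈ A`:
`y_0 ⋯ y_{b-1} (x_a x_{a+1} ⋯ ⊗ x_0 ⋯ x_{a-1} u - u x_{a+1} ⋯ ⊗ x_0 ⋯ x_a) y_{b+1} ⋯`. -/
def splice (K : Type*) {A : Type*} [Field K] [Ring A] [Algebra K A] (x y : List A) (a b : ℕ)
    (u : A) : A ⊗[K] A :=
  ((y.take b).prod * (x.drop a).prod) ⊗ₜ[K] ((x.take a).prod * u * (y.drop (b + 1)).prod) -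
    ((y.take b).prod * u * (x.drop (a + 1)).prod) ⊗ₜ[K]
      ((x.take (a + 1)).prod * (y.drop (b + 1)).prod)

end DoublePoisson

end

open scoped TensorProduct BigOperators

noncomputable section

namespace DoublePoisson

/-! ### Twisted derivations -/

/-! Everything is decided on generators. A double bracket is a derivation in its second argument,
hence by antisymmetry a twisted derivation in its first, so its values on generators determine it.
The triple bracket `jacobiator` is a derivation in its last argument and is cyclically symmetric, so
it vanishes as soon as it does on triples of generators. The one cancellation behind this is in
`IsDoubleBracket.jacobiator_mul`.

For existence on the free product, each arrow of a factor is extended by zero on the other factor. A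
derivation is a homomorphism to upper triangular matrices, so the universal property provides the
extension. The products of these extensions give the bracket; on generators the Jacobi identity is
either that of a factor or a sum of zeros (`exists_isInducedDoubleBracket`).

The same scheme works on the representation space. Derivations of the coordinate ring come from
representations over a square-zero extension (`exists_repRing_derivation`). Used twice, this gives
the biderivation with the prescribed values on coordinates. Antisymmetry, uniqueness, the Jacobi
identity and `GL`-equivariance are then checked on coordinates only. Equivariance makes the
invariants closed under the bracket, and contracting indices gives `{tr a, tr b} = tr(⦃a, b⦄'⦃a,
b⦄'')`.

For the explicit formulas, two letters of one factor always satisfy `⦃e_k, e_l⦄ = e_k ⊗ u - u ⊗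
e_k`. Here `u` is `c̄_{kl} e_l` if `k ≠ l` and `ē_k` if `k = l` (`map_tensorBracket_single`). The
Leibniz rule spreads this over the letters of two words. Multiplying out and taking the trace turns
each summand into a difference of products of cyclic rotations, and one cyclic shift of indices
yields the stated form. -/

/-- A twisted derivation vanishing on algebra generators vanishes. -/
theorem eq_zero_of_leibniz_of_adjoin_eq_top {K A M : Type*} [Field K] [Ring A] [Algebra K A]
    [Ring M] [Algebra K M] (l r : A →ₐ[K] M) (F : A →ₗ[K] M)
    (hF : ∀ a b, F (a * b) = l a * F b + F a * r b) {X : Set A} (hX : Algebra.adjoin K X = ⊤)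
    (h0 : ∀ x ∈ X, F x = 0) (a : A) : F a = 0 := by
  have h1 : F 1 = 0 := by simpa using hF 1 1
  have ha : a ∈ Algebra.adjoin K X := hX ▸ Algebra.mem_top
  induction ha using Algebra.adjoin_induction with
  | mem x hx => exact h0 x hx
  | algebraMap k => rw [Algebra.algebraMap_eq_smul_one, map_smul, h1, smul_zero]
  | add x y _ _ hx hy => rw [map_add, hx, hy, add_zero]
  | mul x y _ _ hx hy => rw [hF, hx, hy, mul_zero, zero_mul, add_zero]

section Brackets

variable {K A : Type*} [Field K] [Ring A] [Algebra K A]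

/-! ### Double derivations and the brackets of their products -/

/-- Double derivations of `A`: derivations `A → A ⊗ A` for the outer bimodule structure. -/
def IsDoubleDer (δ : A →ₗ[K] A ⊗[K] A) : Prop :=
  ∀ a b : A, δ (a * b) = (a ⊗ₜ[K] (1 : A)) * δ b + δ a * ((1 : A) ⊗ₜ[K] b)

/-- Double brackets, without the double Jacobi identity. -/
structure IsDoubleBracket (D : BilinearToTensor K A) : Prop where
  derivation : ∀ a, IsDoubleDer (D a)
  antisymm : ∀ a b : A, D a b = -(TensorProduct.comm K A A (D b a))

theorem IsDoublePoissonBracket.isDoubleBracket {D : BilinearToTensor K A}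
    (h : IsDoublePoissonBracket D) : IsDoubleBracket D :=
  ⟨h.derivation, h.antisymm⟩

theorem IsDoubleDer.map_one {δ : A →ₗ[K] A ⊗[K] A} (h : IsDoubleDer δ) : δ 1 = 0 := by
  have := h 1 1
  rw [mul_one, ← Algebra.TensorProduct.one_def, one_mul, mul_one] at this
  simpa using this

theorem IsDoubleDer.ext {δ δ' : A →ₗ[K] A ⊗[K] A} (h : IsDoubleDer δ) (h' : IsDoubleDer δ')
    {X : Set A} (hX : Algebra.adjoin K X = ⊤) (hδ : ∀ x ∈ X, δ x = δ' x) : δ = δ' := by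
  refine sub_eq_zero.1 (LinearMap.ext fun a => ?_)
  refine eq_zero_of_leibniz_of_adjoin_eq_top
    (Algebra.TensorProduct.includeLeft : A →ₐ[K] A ⊗[K] A)
    (Algebra.TensorProduct.includeRight : A →ₐ[K] A ⊗[K] A) _ (fun a b => ?_) hX
    (fun x hx => by rw [LinearMap.sub_apply, hδ x hx, sub_self]) a
  simp only [LinearMap.sub_apply, h a b, h' a b, Algebra.TensorProduct.includeLeft_apply,
    Algebra.TensorProduct.includeRight_apply]
  noncomm_ring

theorem isDoubleDer_innerDoubleDer (t : A ⊗[K] A) : IsDoubleDer (innerDoubleDer t) := by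
  intro a b
  have h1 : (1 : A) ⊗ₜ[K] (a * b) = (1 ⊗ₜ a) * (1 ⊗ₜ b) := by simp
  have h2 : (a * b) ⊗ₜ[K] (1 : A) = (a ⊗ₜ 1) * (b ⊗ₜ 1) := by simp
  simp only [innerDoubleDer, LinearMap.sub_apply, LinearMap.comp_apply, LinearMap.mulLeft_apply,
    LinearMap.mulRight_apply, AlgHom.toLinearMap_apply, Algebra.TensorProduct.includeLeft_apply,
    Algebra.TensorProduct.includeRight_apply, h1, h2]
  noncomm_ring

theorem interlace_tmul (u v s t : A) :
    interlace K A (u ⊗ₜ v) (s ⊗ₜ t) = (s * v) ⊗ₜ (u * t) := by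
  simp [interlace]

theorem interlace_left_mul (a : A) (x y : A ⊗[K] A) :
    interlace K A x ((a ⊗ₜ 1) * y) = (a ⊗ₜ 1) * interlace K A x y := by
  induction x with
  | zero => simp
  | add x x' hx hx' => simp only [map_add, LinearMap.add_apply, mul_add, hx, hx']
  | tmul u v =>
    induction y with
    | zero => simp
    | add y y' hy hy' => simp only [map_add, mul_add, hy, hy']
    | tmul s t => simp [interlace_tmul, mul_assoc]

/-- With `interlace_left_mul`: the second argument of `interlace` keeps its outer bimodule
structure, which gives the derivation property of `bracketOfPair`; `comm_interlace` gives its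
antisymmetry. -/
theorem interlace_right_mul (a : A) (x y : A ⊗[K] A) :
    interlace K A x (y * (1 ⊗ₜ a)) = interlace K A x y * (1 ⊗ₜ a) := by
  induction x with
  | zero => simp
  | add x x' hx hx' => simp only [map_add, LinearMap.add_apply, add_mul, hx, hx']
  | tmul u v =>
    induction y with
    | zero => simp
    | add y y' hy hy' => simp only [map_add, add_mul, hy, hy']
    | tmul s t => simp [interlace_tmul, mul_assoc]

theorem comm_interlace (x y : A ⊗[K] A) :
    TensorProduct.comm K A A (interlace K A x y) = interlace K A y x := by
  induction x with
  | zero => simp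
  | add x x' hx hx' => simp only [map_add, LinearMap.add_apply, hx, hx']
  | tmul u v =>
    induction y with
    | zero => simp
    | add y y' hy hy' => simp only [map_add, LinearMap.add_apply, hy, hy']
    | tmul s t => simp [interlace_tmul]

theorem bracketOfPair_apply (δ Δ : A →ₗ[K] A ⊗[K] A) (a b : A) :
    bracketOfPair δ Δ a b = interlace K A (δ a) (Δ b) - interlace K A (Δ a) (δ b) := rfl

theorem isDoubleBracket_bracketOfPair {δ Δ : A →ₗ[K] A ⊗[K] A} (hδ : IsDoubleDer δ)
    (hΔ : IsDoubleDer Δ) : IsDoubleBracket (bracketOfPair δ Δ) where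
  derivation a b c := by
    simp only [bracketOfPair_apply, hδ b c, hΔ b c, map_add, interlace_left_mul,
      interlace_right_mul]
    noncomm_ring
  antisymm a b := by
    simp only [bracketOfPair_apply, map_sub, comm_interlace]
    abel

theorem IsDoubleBracket.zero : IsDoubleBracket (0 : BilinearToTensor K A) where
  derivation a b c := by simp
  antisymm a b := by simp

theorem IsDoubleBracket.add {D D' : BilinearToTensor K A} (h : IsDoubleBracket D)
    (h' : IsDoubleBracket D') : IsDoubleBracket (D + D') where
  derivation a b c := by
    simp only [LinearMap.add_apply, h.derivation a b c, h'.derivation a b c, mul_add, add_mul]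
    abel
  antisymm a b := by
    simp only [LinearMap.add_apply, map_add, h.antisymm a b, h'.antisymm a b]
    abel

theorem IsDoubleBracket.smul {D : BilinearToTensor K A} (h : IsDoubleBracket D) (r : K) :
    IsDoubleBracket (r • D) where
  derivation a b c := by
    simp only [LinearMap.smul_apply, h.derivation a b c, smul_add, mul_smul_comm, smul_mul_assoc]
  antisymm a b := by
    simp only [LinearMap.smul_apply, map_smul, h.antisymm a b, smul_neg]

theorem IsDoubleBracket.sum {ι : Type*} (s : Finset ι) {D : ι → BilinearToTensor K A}
    (h : ∀ i, IsDoubleBracket (D i)) : IsDoubleBracket (∑ i ∈ s, D i) := by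
  classical
  induction s using Finset.induction_on with
  | empty => simpa using IsDoubleBracket.zero
  | insert i s hi ih => rw [Finset.sum_insert hi]; exact (h i).add ih

/-! ### Calculus of double brackets -/

theorem comm_mul (x y : A ⊗[K] A) :
    TensorProduct.comm K A A (x * y) =
      TensorProduct.comm K A A x * TensorProduct.comm K A A y :=
  map_mul (Algebra.TensorProduct.comm K A A) x y

namespace IsDoubleBracket

variable {D : BilinearToTensor K A}

/-- Flipping the tensor factors exchanges the outer and the inner bimodule structure, so
antisymmetry transports the Leibniz rule to the first argument. -/
theorem mul_left (h : IsDoubleBracket D) (a b c : A) :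
    D (a * b) c = (1 ⊗ₜ a) * D b c + D a c * (b ⊗ₜ 1) := by
  rw [h.antisymm, h.derivation c a b, map_add, comm_mul, comm_mul, h.antisymm b c,
    h.antisymm a c]
  simp only [TensorProduct.comm_tmul]
  noncomm_ring

theorem ext {D' : BilinearToTensor K A} (h : IsDoubleBracket D) (h' : IsDoubleBracket D')
    {X : Set A} (hX : Algebra.adjoin K X = ⊤) (hD : ∀ x ∈ X, ∀ y ∈ X, D x y = D' x y) :
    D = D' := by
  have h1 : ∀ x ∈ X, D x = D' x := fun x hx =>
    (h.derivation x).ext (h'.derivation x) hX (hD x hx)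
  refine LinearMap.ext fun a => (h.derivation a).ext (h'.derivation a) hX fun x hx => ?_
  rw [h.antisymm, h'.antisymm, h1 x hx]

end IsDoubleBracket

/-! ### The double Jacobi identity on generators. -/

/-- `x ⊗ 1` for `x ∈ A ⊗ A`. -/
abbrev incl₁₂ (K A : Type*) [Field K] [Ring A] [Algebra K A] :
    A ⊗[K] A →ₐ[K] (A ⊗[K] A) ⊗[K] A :=
  Algebra.TensorProduct.includeLeft

/-- `1 ⊗ x` for `x ∈ A ⊗ A`. -/
abbrev incl₂₃ (K A : Type*) [Field K] [Ring A] [Algebra K A] :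
    A ⊗[K] A →ₐ[K] (A ⊗[K] A) ⊗[K] A :=
  Algebra.TensorProduct.map Algebra.TensorProduct.includeRight (AlgHom.id K A)

theorem cyc_tmul (x y z : A) :
    cyc K A ((x ⊗ₜ y) ⊗ₜ z) = (z ⊗ₜ x) ⊗ₜ y := by
  simp [cyc]

theorem cyc_cyc_cyc (x : (A ⊗[K] A) ⊗[K] A) : cyc K A (cyc K A (cyc K A x)) = x := by
  have : (cyc K A ∘ₗ cyc K A ∘ₗ cyc K A) = LinearMap.id :=
    TensorProduct.ext_threefold fun x y z => by simp [cyc_tmul]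
  exact LinearMap.congr_fun this x

theorem cyc_mul (x y : (A ⊗[K] A) ⊗[K] A) : cyc K A (x * y) = cyc K A x * cyc K A y := by
  have : (LinearMap.mul K ((A ⊗[K] A) ⊗[K] A)).compr₂ (cyc K A) =
      (LinearMap.mul K ((A ⊗[K] A) ⊗[K] A)).compl₁₂ (cyc K A) (cyc K A) := by
    refine TensorProduct.ext_threefold fun x y z => TensorProduct.ext_threefold fun u v w => ?_
    simp [cyc_tmul]
  exact LinearMap.congr_fun (LinearMap.congr_fun this x) y

/-- The left-hand side `⦃a, b, c⦄` of the double Jacobi identity. -/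
def jacobiator (D : BilinearToTensor K A) (a b c : A) : (A ⊗[K] A) ⊗[K] A :=
  nested D a b c + cyc K A (nested D b c a) + cyc K A (cyc K A (nested D c a b))

theorem cyc_jacobiator (D : BilinearToTensor K A) (a b c : A) :
    cyc K A (jacobiator D b c a) = jacobiator D a b c := by
  simp only [jacobiator, map_add, cyc_cyc_cyc]
  abel

/-- `⦃a, b, -⦄` as a linear map. -/
def jacobiatorₗ (D : BilinearToTensor K A) (a b : A) : A →ₗ[K] (A ⊗[K] A) ⊗[K] A :=
  (D a).rTensor A ∘ₗ D b + cyc K A ∘ₗ (D b).rTensor A ∘ₗ D.flip a +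
    cyc K A ∘ₗ cyc K A ∘ₗ (LinearMap.rTensorHom A ∘ₗ D).flip (D a b)

namespace IsDoubleBracket

variable {D : BilinearToTensor K A}

/-- The extra term arises because `D a` also differentiates the factor `c` in the first leg. It is
one of the two cross terms that meet in `jacobiator_mul`. -/
theorem rTensor_left_mul (h : IsDoubleBracket D) (a c : A) (x : A ⊗[K] A) :
    (D a).rTensor A ((c ⊗ₜ 1) * x) =
      ((c ⊗ₜ 1) ⊗ₜ 1) * (D a).rTensor A x + incl₁₂ K A (D a c) * incl₂₃ K A x := by
  induction x with
  | zero => simp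
  | add x y hx hy => simp only [mul_add, map_add, hx, hy]; abel
  | tmul u v => simp [h.derivation a c u, TensorProduct.add_tmul]

theorem rTensor_right_mul (c : A) (δ : A →ₗ[K] A ⊗[K] A) (x : A ⊗[K] A) :
    δ.rTensor A (x * (1 ⊗ₜ c)) = δ.rTensor A x * (1 ⊗ₜ c) := by
  induction x with
  | zero => simp
  | add x y hx hy => simp only [add_mul, map_add, hx, hy]
  | tmul u v => simp

theorem rTensor_inner_left_mul (c : A) (δ : A →ₗ[K] A ⊗[K] A) (x : A ⊗[K] A) :
    δ.rTensor A ((1 ⊗ₜ c) * x) = (1 ⊗ₜ c) * δ.rTensor A x := by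
  induction x with
  | zero => simp
  | add x y hx hy => simp only [mul_add, map_add, hx, hy]
  | tmul u v => simp

/-- Source of the second cross term; for `x = D c a` the flip of `x` is `-D a c`, so it is opposite
to the one from `rTensor_left_mul`. -/
theorem rTensor_inner_right_mul (h : IsDoubleBracket D) (b d : A) (x : A ⊗[K] A) :
    cyc K A ((D b).rTensor A (x * (d ⊗ₜ 1))) =
      incl₁₂ K A (TensorProduct.comm K A A x) * incl₂₃ K A (D b d) +
        cyc K A ((D b).rTensor A x) * (1 ⊗ₜ d) := by
  induction x with
  | zero => simp
  | add x y hx hy => simp only [add_mul, map_add, hx, hy]; abel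
  | tmul u v =>
    have h1 : ∀ y : A ⊗[K] A, cyc K A (((u ⊗ₜ 1) * y) ⊗ₜ v) =
        incl₁₂ K A (v ⊗ₜ u) * incl₂₃ K A y := by
      intro y
      induction y with
      | zero => simp
      | add y y' hy hy' => simp only [mul_add, map_add, TensorProduct.add_tmul, hy, hy']
      | tmul s t => simp [cyc_tmul]
    have h2 : cyc K A ((D b u * (1 ⊗ₜ d)) ⊗ₜ v) = cyc K A (D b u ⊗ₜ v) * (1 ⊗ₜ d) := by
      rw [show (1 : A ⊗[K] A) ⊗ₜ[K] d = cyc K A ((1 ⊗ₜ d) ⊗ₜ 1) by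
        simp [cyc_tmul, Algebra.TensorProduct.one_def], ← cyc_mul]
      simp
    simp only [Algebra.TensorProduct.tmul_mul_tmul, mul_one, LinearMap.rTensor_tmul,
      h.derivation b u d, TensorProduct.add_tmul, map_add, h1, h2, TensorProduct.comm_tmul]

theorem rTensor_mul_left (h : IsDoubleBracket D) (c d : A) (x : A ⊗[K] A) :
    (D (c * d)).rTensor A x =
      ((1 ⊗ₜ c) ⊗ₜ 1) * (D d).rTensor A x + (D c).rTensor A x * ((d ⊗ₜ 1) ⊗ₜ 1) := by
  induction x with
  | zero => simp
  | add x y hx hy => simp only [map_add, mul_add, add_mul, hx, hy]; abel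
  | tmul u v => simp [h.mul_left c d u, TensorProduct.add_tmul]

/-- The expression `⦃a, b, c⦄` is a derivation in `c`. -/
theorem jacobiator_mul (h : IsDoubleBracket D) (a b c d : A) :
    jacobiator D a b (c * d) =
      ((c ⊗ₜ 1) ⊗ₜ 1) * jacobiator D a b d + jacobiator D a b c * (1 ⊗ₜ d) := by
  have e1 : nested D a b (c * d) = ((c ⊗ₜ 1) ⊗ₜ 1) * nested D a b d +
      incl₁₂ K A (D a c) * incl₂₃ K A (D b d) + nested D a b c * (1 ⊗ₜ d) := by
    rw [nested, h.derivation b c d, map_add, h.rTensor_left_mul, rTensor_right_mul]; rfl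
  have e2 : cyc K A (nested D b (c * d) a) = ((c ⊗ₜ 1) ⊗ₜ 1) * cyc K A (nested D b d a) +
      (-(incl₁₂ K A (D a c) * incl₂₃ K A (D b d)) + cyc K A (nested D b c a) * (1 ⊗ₜ d)) := by
    -- Antisymmetry supplies the sign by which the cross terms of `e1` and `e2` cancel.
    have hc : incl₁₂ K A (TensorProduct.comm K A A (D c a)) = -incl₁₂ K A (D a c) := by
      rw [h.antisymm a c, map_neg, neg_neg]
    have hneg (x y : (A ⊗[K] A) ⊗[K] A) : -x * y = -(x * y) := neg_mul x y
    rw [nested, h.mul_left c d a, map_add, map_add, rTensor_inner_left_mul,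
      h.rTensor_inner_right_mul, cyc_mul, hc, hneg, Algebra.TensorProduct.one_def, cyc_tmul]
    rfl
  have e3 : cyc K A (cyc K A (nested D (c * d) a b)) =
      ((c ⊗ₜ 1) ⊗ₜ 1) * cyc K A (cyc K A (nested D d a b)) +
        cyc K A (cyc K A (nested D c a b)) * (1 ⊗ₜ d) := by
    rw [nested, h.rTensor_mul_left, map_add, map_add, cyc_mul, cyc_mul, cyc_mul, cyc_mul]
    simp only [cyc_tmul, Algebra.TensorProduct.one_def]
    rfl
  rw [jacobiator, e1, e2, e3, jacobiator, jacobiator]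
  noncomm_ring

/-- The last argument reduces to generators by the Leibniz rule; cyclic symmetry then moves each of
the other two arguments into the last place. -/
theorem jacobiator_eq_zero_of_adjoin_eq_top (h : IsDoubleBracket D) {X : Set A}
    (hX : Algebra.adjoin K X = ⊤)
    (h0 : ∀ x ∈ X, ∀ y ∈ X, ∀ z ∈ X, jacobiator D x y z = 0) (a b c : A) :
    jacobiator D a b c = 0 := by
  have key : ∀ a b : A, (∀ x ∈ X, jacobiator D a b x = 0) → ∀ c, jacobiator D a b c = 0 :=
    fun a b hab c => eq_zero_of_leibniz_of_adjoin_eq_top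
      ((incl₁₂ K A).comp Algebra.TensorProduct.includeLeft)
      (Algebra.TensorProduct.includeRight : A →ₐ[K] (A ⊗[K] A) ⊗[K] A) (jacobiatorₗ D a b)
      (h.jacobiator_mul a b) hX hab c
  have h1 : ∀ x ∈ X, ∀ y ∈ X, ∀ c, jacobiator D x y c = 0 := fun x hx y hy =>
    key x y (h0 x hx y hy)
  have h2 : ∀ x ∈ X, ∀ b c, jacobiator D b x c = 0 := fun x hx b => key b x fun y hy => by
    rw [← cyc_jacobiator, h1 x hx y hy, map_zero]
  exact key a b (fun x hx => by rw [← cyc_jacobiator, h2 x hx, map_zero]) c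

end IsDoubleBracket

end Brackets

/-! ### Derivations as triangular matrix representations, and base change. -/

section Lift

variable {K A S : Type*} [Field K] [Ring A] [Algebra K A] [Ring S] [Algebra K S]

/-- The homomorphism `s ↦ (s ⊗ 1, δ(s); 0, 1 ⊗ s)` to `2 × 2` matrices over `A ⊗ A` attached to
a derivation `δ : S → A ⊗ A` over a homomorphism `S → A`. -/
def derivationMatrix (ι : S →ₐ[K] A) (δ : S →ₗ[K] A ⊗[K] A)
    (hδ : ∀ s t, δ (s * t) = (ι s ⊗ₜ[K] (1 : A)) * δ t + δ s * ((1 : A) ⊗ₜ[K] ι t)) :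
    S →ₐ[K] Matrix (Fin 2) (Fin 2) (A ⊗[K] A) :=
  AlgHom.ofLinearMap
    { toFun := fun s => !![ι s ⊗ₜ[K] (1 : A), δ s; 0, (1 : A) ⊗ₜ[K] ι s]
      map_add' := fun s t => by
        ext i j
        fin_cases i <;> fin_cases j <;> simp [TensorProduct.add_tmul, TensorProduct.tmul_add]
      map_smul' := fun r s => by
        ext i j
        fin_cases i <;> fin_cases j <;> simp [TensorProduct.smul_tmul'] }
    (by
      have h1 : δ 1 = 0 := by
        have := hδ 1 1
        rw [mul_one, map_one ι, ← Algebra.TensorProduct.one_def, one_mul, mul_one] at this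
        simpa using this
      ext i j
      fin_cases i <;> fin_cases j <;> simp [h1, Algebra.TensorProduct.one_def])
    (fun s t => by
      ext i j
      fin_cases i <;> fin_cases j <;> simp [Matrix.mul_apply, hδ])

theorem derivationMatrix_apply (ι : S →ₐ[K] A) (δ : S →ₗ[K] A ⊗[K] A)
    (hδ : ∀ s t, δ (s * t) = (ι s ⊗ₜ[K] (1 : A)) * δ t + δ s * ((1 : A) ⊗ₜ[K] ι t)) (s : S) :
    derivationMatrix ι δ hδ s = !![ι s ⊗ₜ[K] (1 : A), δ s; 0, (1 : A) ⊗ₜ[K] ι s] := rfl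

theorem IsDoubleDer.map {δ : S →ₗ[K] S ⊗[K] S} (hδ : IsDoubleDer δ) (ι : S →ₐ[K] A) (s t : S) :
    (TensorProduct.map ι.toLinearMap ι.toLinearMap ∘ₗ δ) (s * t) =
      (ι s ⊗ₜ[K] (1 : A)) * (TensorProduct.map ι.toLinearMap ι.toLinearMap ∘ₗ δ) t +
        (TensorProduct.map ι.toLinearMap ι.toLinearMap ∘ₗ δ) s * ((1 : A) ⊗ₜ[K] ι t) := by
  have h : ∀ x y : S ⊗[K] S, TensorProduct.map ι.toLinearMap ι.toLinearMap (x * y) =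
      TensorProduct.map ι.toLinearMap ι.toLinearMap x *
        TensorProduct.map ι.toLinearMap ι.toLinearMap y :=
    map_mul (Algebra.TensorProduct.map ι ι)
  simp [hδ s t, h]

theorem interlace_map (ι : S →ₐ[K] A) (x y : S ⊗[K] S) :
    interlace K A (TensorProduct.map ι.toLinearMap ι.toLinearMap x)
      (TensorProduct.map ι.toLinearMap ι.toLinearMap y) =
    TensorProduct.map ι.toLinearMap ι.toLinearMap (interlace K S x y) := by
  induction x with
  | zero => simp
  | add x x' hx hx' => simp only [map_add, LinearMap.add_apply, hx, hx']
  | tmul u v =>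
    induction y with
    | zero => simp
    | add y y' hy hy' => simp only [map_add, hy, hy']
    | tmul s t => simp [interlace_tmul]

end Lift

/-! ### Double derivations and brackets on the free product. -/

section FreeProd

variable {K : Type*} [Field K] {n m : ℕ}

theorem exists_freeProd_lift {B : Type*} [Ring B] [Algebra K B] (φ : (Fin n → K) →ₐ[K] B)
    (ψ : (Fin m → K) →ₐ[K] B) :
    ∃ g : FreeProd K n m →ₐ[K] B, (∀ s, g (inl K n m s) = φ s) ∧ ∀ t, g (inr K n m t) = ψ t := by
  let maps : ∀ {b : Fin 2}, (Fin (![n, m] b) → K) →ₐ[K] B :=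
    fun {b} => match b with
      | 0 => φ
      | 1 => ψ
  refine ⟨LinearAlgebra.FreeProduct.lift K _ maps, fun s => ?_, fun t => ?_⟩
  · exact DFunLike.congr_fun (LinearAlgebra.FreeProduct.lift_comp_ι K
      (fun b : Fin 2 => Fin (![n, m] b) → K) maps (i := 0)) s
  · exact DFunLike.congr_fun (LinearAlgebra.FreeProduct.lift_comp_ι K
      (fun b : Fin 2 => Fin (![n, m] b) → K) maps (i := 1)) t

theorem freeProd_hom_ext {B : Type*} [Ring B] [Algebra K B] {g g' : FreeProd K n m →ₐ[K] B}
    (hl : ∀ s, g (inl K n m s) = g' (inl K n m s))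
    (hr : ∀ t, g (inr K n m t) = g' (inr K n m t)) : g = g' := by
  refine (LinearAlgebra.FreeProduct.lift K (fun b : Fin 2 => Fin (![n, m] b) → K)).symm.injective
    ?_
  funext b
  match b with
  | 0 => exact AlgHom.ext hl
  | 1 => exact AlgHom.ext hr

/-- The elements of the two factors of the free product. -/
def factors (K : Type*) [Field K] (n m : ℕ) : Set (FreeProd K n m) :=
  Set.range (inl K n m) ∪ Set.range (inr K n m)

/-- The universal map into the generated subalgebra, followed by the inclusion, fixes both factors
and is therefore the identity. -/
theorem adjoin_factors : Algebra.adjoin K (factors K n m) = ⊤ := by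
  set H := Algebra.adjoin K (factors K n m)
  have hl : ∀ s, inl K n m s ∈ H := fun s => Algebra.subset_adjoin (Or.inl ⟨s, rfl⟩)
  have hr : ∀ t, inr K n m t ∈ H := fun t => Algebra.subset_adjoin (Or.inr ⟨t, rfl⟩)
  obtain ⟨g, gl, gr⟩ := exists_freeProd_lift (K := K) (B := H) ((inl K n m).codRestrict H hl)
    ((inr K n m).codRestrict H hr)
  have hg : H.val.comp g = AlgHom.id K _ :=
    freeProd_hom_ext (fun s => by simp [gl]) (fun t => by simp [gr])
  refine Algebra.eq_top_iff.2 fun a => ?_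
  rw [show a = g a from (DFunLike.congr_fun hg a).symm]
  exact (g a).2

/-- The two triangular representations glue by the universal property. The upper right entry of the
resulting homomorphism is the derivation, and its multiplication rule is the Leibniz rule. -/
theorem exists_doubleDer_freeProd
    (δ₁ : (Fin n → K) →ₗ[K] FreeProd K n m ⊗[K] FreeProd K n m)
    (h₁ : ∀ s t, δ₁ (s * t) =
      (inl K n m s ⊗ₜ[K] (1 : FreeProd K n m)) * δ₁ t + δ₁ s * (1 ⊗ₜ[K] inl K n m t))
    (δ₂ : (Fin m → K) →ₗ[K] FreeProd K n m ⊗[K] FreeProd K n m)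
    (h₂ : ∀ s t, δ₂ (s * t) =
      (inr K n m s ⊗ₜ[K] (1 : FreeProd K n m)) * δ₂ t + δ₂ s * (1 ⊗ₜ[K] inr K n m t)) :
    ∃ δ : FreeProd K n m →ₗ[K] FreeProd K n m ⊗[K] FreeProd K n m, IsDoubleDer δ ∧
      (∀ s, δ (inl K n m s) = δ₁ s) ∧ ∀ t, δ (inr K n m t) = δ₂ t := by
  obtain ⟨g, gl, gr⟩ := exists_freeProd_lift (derivationMatrix (inl K n m) δ₁ h₁)
    (derivationMatrix (inr K n m) δ₂ h₂)
  have hgen : ∀ x ∈ factors K n m, g x 1 0 = 0 ∧ g x 0 0 = x ⊗ₜ 1 ∧ g x 1 1 = 1 ⊗ₜ x := by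
    rintro _ (⟨s, rfl⟩ | ⟨t, rfl⟩)
    · simp [gl, derivationMatrix_apply]
    · simp [gr, derivationMatrix_apply]
  -- The shape of the other three entries is closed under the algebra operations, so it passes from
  -- generators to all elements.
  have hg : ∀ a, g a 1 0 = 0 ∧ g a 0 0 = a ⊗ₜ 1 ∧ g a 1 1 = 1 ⊗ₜ a := by
    intro a
    have ha : a ∈ Algebra.adjoin K (factors K n m) := (adjoin_factors (K := K)).symm ▸ Algebra.mem_top
    induction ha using Algebra.adjoin_induction with
    | mem x hx => exact hgen x hx
    | algebraMap k =>
      simp [Algebra.algebraMap_eq_smul_one, TensorProduct.smul_tmul', Algebra.TensorProduct.one_def]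
    | add x y _ _ hx hy =>
      simp [hx, hy, TensorProduct.add_tmul, TensorProduct.tmul_add]
    | mul x y _ _ hx hy =>
      simp [Matrix.mul_apply, hx, hy]
  refine ⟨Matrix.entryLinearMap K _ 0 1 ∘ₗ g.toLinearMap, fun a b => ?_, fun s => ?_, fun t => ?_⟩
  · simp [Matrix.mul_apply, hg]
  · simp [gl, derivationMatrix_apply]
  · simp [gr, derivationMatrix_apply]

theorem tensorBracket_apply (c : Fin n → Fin n → K) (s s' : Fin n → K) :
    tensorBracket c s s' =
      ∑ i, ∑ j, c i j • bracketOfPair (arrow K i j) (arrow K j i) s s' := by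
  simp [tensorBracket]

/-- Every arrow is extended by zero on the second factor, and the same combination of products of
arrows is formed upstairs. -/
theorem exists_left_bracket (c : Fin n → Fin n → K) :
    ∃ D : BilinearToTensor K (FreeProd K n m), IsDoubleBracket D ∧
      (∀ s s', D (inl K n m s) (inl K n m s') =
        TensorProduct.map (inl K n m).toLinearMap (inl K n m).toLinearMap
          (tensorBracket c s s')) ∧
      (∀ t a, D (inr K n m t) a = 0) := by
  have h : ∀ i j, ∃ δ : FreeProd K n m →ₗ[K] FreeProd K n m ⊗[K] FreeProd K n m, IsDoubleDer δ ∧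
      (∀ s, δ (inl K n m s) =
        (TensorProduct.map (inl K n m).toLinearMap (inl K n m).toLinearMap ∘ₗ arrow K i j) s) ∧
      ∀ t, δ (inr K n m t) = (0 : (Fin m → K) →ₗ[K] FreeProd K n m ⊗[K] FreeProd K n m) t :=
    fun i j => exists_doubleDer_freeProd _ ((isDoubleDer_innerDoubleDer _).map _) _ (by simp)
  choose α hα hl hr using h
  refine ⟨∑ i, ∑ j, c i j • bracketOfPair (α i j) (α j i), ?_, fun s s' => ?_, fun t a => ?_⟩
  · exact .sum _ fun i => .sum _ fun j => (isDoubleBracket_bracketOfPair (hα _ _) (hα _ _)).smul _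
  · simp only [tensorBracket_apply, LinearMap.sum_apply, LinearMap.smul_apply, map_sum, map_smul,
      bracketOfPair_apply, hl, LinearMap.comp_apply, interlace_map, map_sub]
  · simp [bracketOfPair_apply, hr]

theorem exists_right_bracket (d : Fin m → Fin m → K) :
    ∃ D : BilinearToTensor K (FreeProd K n m), IsDoubleBracket D ∧
      (∀ t t', D (inr K n m t) (inr K n m t') =
        TensorProduct.map (inr K n m).toLinearMap (inr K n m).toLinearMap
          (tensorBracket d t t')) ∧
      (∀ s a, D (inl K n m s) a = 0) := by
  have h : ∀ i j, ∃ δ : FreeProd K n m →ₗ[K] FreeProd K n m ⊗[K] FreeProd K n m, IsDoubleDer δ ∧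
      (∀ s, δ (inl K n m s) = (0 : (Fin n → K) →ₗ[K] FreeProd K n m ⊗[K] FreeProd K n m) s) ∧
      ∀ t, δ (inr K n m t) =
        (TensorProduct.map (inr K n m).toLinearMap (inr K n m).toLinearMap ∘ₗ arrow K i j) t :=
    fun i j => exists_doubleDer_freeProd _ (by simp) _ ((isDoubleDer_innerDoubleDer _).map _)
  choose α hα hl hr using h
  refine ⟨∑ i, ∑ j, d i j • bracketOfPair (α i j) (α j i), ?_, fun s s' => ?_, fun t a => ?_⟩
  · exact .sum _ fun i => .sum _ fun j => (isDoubleBracket_bracketOfPair (hα _ _) (hα _ _)).smul _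
  · simp only [tensorBracket_apply, LinearMap.sum_apply, LinearMap.smul_apply, map_sum, map_smul,
      bracketOfPair_apply, hr, LinearMap.comp_apply, interlace_map, map_sub]
  · simp [bracketOfPair_apply, hl]

end FreeProd

/-! ### Naturality of the double Jacobi expression. -/

section Nested

variable {K A S : Type*} [Field K] [Ring A] [Algebra K A] [Ring S] [Algebra K S]

theorem rTensor_map_eq_zero (ι : S →ₐ[K] A) {δ : A →ₗ[K] A ⊗[K] A} (hδ : ∀ s, δ (ι s) = 0)
    (x : S ⊗[K] S) :
    δ.rTensor A (TensorProduct.map ι.toLinearMap ι.toLinearMap x) = 0 := by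
  induction x with
  | zero => simp
  | add x y hx hy => simp only [map_add, hx, hy, add_zero]
  | tmul u v => simp [hδ]

theorem jacobiator_map (ι : S →ₐ[K] A) {D : BilinearToTensor K A} {D₀ : BilinearToTensor K S}
    (h : ∀ s t, D (ι s) (ι t) = TensorProduct.map ι.toLinearMap ι.toLinearMap (D₀ s t))
    (a b c : S) :
    jacobiator D (ι a) (ι b) (ι c) =
      TensorProduct.map (TensorProduct.map ι.toLinearMap ι.toLinearMap) ι.toLinearMap
        (jacobiator D₀ a b c) := by
  have h1 : ∀ a b c, nested D (ι a) (ι b) (ι c) =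
      TensorProduct.map (TensorProduct.map ι.toLinearMap ι.toLinearMap) ι.toLinearMap
        (nested D₀ a b c) := by
    intro a b c
    rw [nested, nested, h]
    induction D₀ b c with
    | zero => simp
    | add x y hx hy => simp only [map_add, hx, hy]
    | tmul u v => simp [h]
  have h2 : ∀ x, cyc K A
      (TensorProduct.map (TensorProduct.map ι.toLinearMap ι.toLinearMap) ι.toLinearMap x) =
      TensorProduct.map (TensorProduct.map ι.toLinearMap ι.toLinearMap) ι.toLinearMap
        (cyc K S x) := by
    refine LinearMap.congr_fun (f := cyc K A ∘ₗ TensorProduct.map _ _)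
      (g := TensorProduct.map _ _ ∘ₗ cyc K S) (TensorProduct.ext_threefold fun x y z => ?_)
    simp [cyc_tmul]
  simp only [jacobiator, h1, h2, map_add]

end Nested

/-! ### Existence and uniqueness of the induced double bracket. -/

section FreeProd

variable {K : Type*} [Field K] {n m : ℕ}

/-- The bracket is the sum of the two one-sided brackets. The bracket of two elements of one factor
has both legs in that factor, so a nested bracket involving both factors vanishes; the Poisson
hypotheses handle triples from a single factor. -/
theorem exists_isInducedDoubleBracket {c : Fin n → Fin n → K} {d : Fin m → Fin m → K}
    (hc : IsDoublePoissonTensor c) (hd : IsDoublePoissonTensor d) :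
    ∃ D : BilinearToTensor K (FreeProd K n m), IsInducedDoubleBracket c d D := by
  obtain ⟨D₁, h₁, l₁, r₁⟩ := exists_left_bracket (m := m) c
  obtain ⟨D₂, h₂, r₂, l₂⟩ := exists_right_bracket (n := n) d
  have h : IsDoubleBracket (D₁ + D₂) := h₁.add h₂
  have hl : ∀ s s', (D₁ + D₂) (inl K n m s) (inl K n m s') =
      TensorProduct.map (inl K n m).toLinearMap (inl K n m).toLinearMap
        (tensorBracket c s s') := fun s s' => by
    rw [LinearMap.add_apply, LinearMap.add_apply, l₁, l₂, add_zero]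
  have hr : ∀ s s', (D₁ + D₂) (inr K n m s) (inr K n m s') =
      TensorProduct.map (inr K n m).toLinearMap (inr K n m).toLinearMap
        (tensorBracket d s s') := fun s s' => by
    rw [LinearMap.add_apply, LinearMap.add_apply, r₁, r₂, zero_add]
  have hlr : ∀ s t, (D₁ + D₂) (inl K n m s) (inr K n m t) = 0 := fun s t => by
    rw [LinearMap.add_apply, LinearMap.add_apply, l₂, h₁.antisymm, r₁, map_zero, neg_zero,
      add_zero]
  have hrl : ∀ s t, (D₁ + D₂) (inr K n m t) (inl K n m s) = 0 := fun s t => by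
    rw [h.antisymm, hlr, map_zero, neg_zero]
  refine ⟨D₁ + D₂, ⟨h.derivation, h.antisymm, ?_⟩, hl, hr, hlr⟩
  generalize D₁ + D₂ = D at h hl hr hlr hrl
  refine h.jacobiator_eq_zero_of_adjoin_eq_top adjoin_factors ?_
  have zl : ∀ t s s', (D (inr K n m t)).rTensor (FreeProd K n m)
      (D (inl K n m s) (inl K n m s')) = 0 := fun t s s' => by
    rw [hl, rTensor_map_eq_zero _ fun s => hrl s t]
  have zr : ∀ s t t', (D (inl K n m s)).rTensor (FreeProd K n m)
      (D (inr K n m t) (inr K n m t')) = 0 := fun s t t' => by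
    rw [hr, rTensor_map_eq_zero _ (hlr s)]
  rintro _ (⟨x, rfl⟩ | ⟨x, rfl⟩) _ (⟨y, rfl⟩ | ⟨y, rfl⟩) _ (⟨z, rfl⟩ | ⟨z, rfl⟩)
  · rw [jacobiator_map _ hl]
    exact (congrArg _ (hc.jacobi x y z)).trans (map_zero _)
  -- The six mixed triples lie between the two pure ones in the order of the case split.
  iterate 6 simp only [jacobiator, nested, hlr, hrl, zl, zr, map_zero, add_zero]
  · rw [jacobiator_map _ hr]
    exact (congrArg _ (hd.jacobi x y z)).trans (map_zero _)

theorem IsInducedDoubleBracket.mixed' {c : Fin n → Fin n → K} {d : Fin m → Fin m → K}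
    {D : BilinearToTensor K (FreeProd K n m)} (h : IsInducedDoubleBracket c d D)
    (s : Fin n → K) (t : Fin m → K) : D (inr K n m t) (inl K n m s) = 0 := by
  rw [h.poisson.antisymm, h.mixed, map_zero, neg_zero]

theorem IsInducedDoubleBracket.unique {c : Fin n → Fin n → K} {d : Fin m → Fin m → K}
    {D D' : BilinearToTensor K (FreeProd K n m)} (h : IsInducedDoubleBracket c d D)
    (h' : IsInducedDoubleBracket c d D') : D = D' := by
  refine h.poisson.isDoubleBracket.ext h'.poisson.isDoubleBracket adjoin_factors ?_
  rintro _ (⟨x, rfl⟩ | ⟨x, rfl⟩) _ (⟨y, rfl⟩ | ⟨y, rfl⟩)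
  · rw [h.left, h'.left]
  · rw [h.mixed, h'.mixed]
  · rw [h.mixed', h'.mixed']
  · rw [h.right, h'.right]

end FreeProd

section Rep

variable {K A : Type*} [Field K] [Ring A] [Algebra K A] {N : ℕ}

/-! ### Derivations of the coordinate ring of the representation space -/

/-- The coordinate functions on the representation space. -/
def coords (K A : Type*) [Field K] [Ring A] [Algebra K A] (N : ℕ) : Set (RepRing K A N) :=
  {x | ∃ i j a, x = coord K A i j a}

theorem adjoin_coords : Algebra.adjoin K (coords K A N) = ⊤ := by
  let π := Ideal.Quotient.mkₐ K (Ideal.span {p | RepRel K A N p})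
  have hπ : Function.Surjective π := Ideal.Quotient.mkₐ_surjective K _
  have h1 : coords K A N = π '' Set.range MvPolynomial.X := by
    ext x
    constructor
    · rintro ⟨i, j, a, rfl⟩
      exact ⟨_, ⟨(a, i, j), rfl⟩, rfl⟩
    · rintro ⟨_, ⟨⟨a, i, j⟩, rfl⟩, rfl⟩
      exact ⟨i, j, a, rfl⟩
  rw [h1, ← AlgHom.map_adjoin, MvPolynomial.adjoin_range_X, Algebra.map_top,
    AlgHom.range_eq_top]
  exact hπ

theorem repRing_derivation_eq_zero {R : Type*} [CommRing R] [Algebra K R]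
    (φ : RepRing K A N →ₐ[K] R) (F : RepRing K A N →ₗ[K] R)
    (hF : ∀ x y, F (x * y) = φ x * F y + F x * φ y)
    (h0 : ∀ i j a, F (coord K A i j a) = 0) : F = 0 :=
  LinearMap.ext <| eq_zero_of_leibniz_of_adjoin_eq_top φ φ F hF adjoin_coords <| by
    rintro _ ⟨i, j, a, rfl⟩
    exact h0 i j a

/-- The twist `φ` is the identity for antisymmetry and uniqueness, and conjugation by `g` for
equivariance. -/
theorem repRing_biderivation_eq_zero {R : Type*} [CommRing R] [Algebra K R]
    (φ : RepRing K A N →ₐ[K] R) (G : RepRing K A N →ₗ[K] RepRing K A N →ₗ[K] R)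
    (hl : ∀ x y z, G (x * y) z = φ x * G y z + G x z * φ y)
    (hr : ∀ x y z, G x (y * z) = φ y * G x z + G x y * φ z)
    (h0 : ∀ i j a k l b, G (coord K A i j a) (coord K A k l b) = 0) : G = 0 := by
  refine LinearMap.ext fun x => repRing_derivation_eq_zero φ (G x) (hr x) fun k l b => ?_
  exact LinearMap.congr_fun (repRing_derivation_eq_zero φ (G.flip (coord K A k l b))
    (fun x y => hl x y _) fun i j a => h0 i j a k l b) x

theorem repRing_hom_ext {R : Type*} [CommRing R] [Algebra K R]
    {φ ψ : RepRing K A N →ₐ[K] R}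
    (h : ∀ i j a, φ (coord K A i j a) = ψ (coord K A i j a)) : φ = ψ := by
  refine AlgHom.ext_of_adjoin_eq_top adjoin_coords ?_
  rintro _ ⟨i, j, a, rfl⟩
  exact h i j a

/-- A family of maps `θ_{ij} : A → M` with `θ(ab) = aθ(b) + θ(a)b` as matrices extends to a
derivation of the coordinate ring with `a_{ij} ↦ θ_{ij}(a)`. -/
theorem exists_repRing_derivation {M : Type*} [AddCommGroup M] [Module K M]
    [Module (RepRing K A N) M] [Module (RepRing K A N)ᵐᵒᵖ M] [IsCentralScalar (RepRing K A N) M]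
    [IsScalarTower K (RepRing K A N) M] [IsScalarTower K (RepRing K A N)ᵐᵒᵖ M]
    (θ : Fin N → Fin N → A →ₗ[K] M)
    (hθ : ∀ i j a b, θ i j (a * b) =
      ∑ l, (coord K A i l a • θ l j b + coord K A l j b • θ i l a)) :
    ∃ F : RepRing K A N →ₗ[K] M, (∀ x y, F (x * y) = x • F y + y • F x) ∧
      ∀ i j a, F (coord K A i j a) = θ i j a := by
  have h1 : ∀ i j, θ i j 1 = 0 := fun i j => by
    have h0 : ∀ x : M, (0 : RepRing K A N) • x = 0 :=
      fun x => zero_smul (RepRing K A N) x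
    simpa [coord_one, Finset.sum_add_distrib, ite_smul, h0] using hθ i j 1 1
  -- The condition on `θ` says exactly that coordinates perturbed by `θ` form a representation over
  -- the square-zero extension of the coordinate ring by `M`.
  let ρ : A →ₐ[K] Matrix (Fin N) (Fin N) (TrivSqZeroExt (RepRing K A N) M) :=
    AlgHom.ofLinearMap
      { toFun := fun a => Matrix.of fun i j =>
          TrivSqZeroExt.inl (coord K A i j a) + TrivSqZeroExt.inr (θ i j a)
        map_add' := fun a b => by
          ext i j <;> simp
        map_smul' := fun r a => by
          ext i j <;> simp }
      (by
        ext i j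
        · by_cases h : i = j <;> simp [coord_one, h, Matrix.one_apply]
        · by_cases h : i = j <;> simp [h1, h, Matrix.one_apply])
      (fun a b => by
        ext i j
        · simp [Matrix.mul_apply, coord_mul, TrivSqZeroExt.fst_sum]
        · simp [Matrix.mul_apply, hθ, TrivSqZeroExt.snd_sum])
  have hρ : ∀ i j a, repLift ρ (coord K A i j a) =
      TrivSqZeroExt.inl (coord K A i j a) + TrivSqZeroExt.inr (θ i j a) := fun i j a =>
    repLift_coord ρ a i j
  -- The classifying homomorphism is a section of the projection, so its second component is an
  -- untwisted derivation.
  have hfst : ∀ x, (repLift ρ x).fst = x := DFunLike.congr_fun (f :=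
    (TrivSqZeroExt.fstHom K (RepRing K A N) M).comp (repLift ρ)) (g := AlgHom.id K _)
      (repRing_hom_ext fun i j a => by simp [hρ])
  refine ⟨(TrivSqZeroExt.sndHom (RepRing K A N) M).restrictScalars K ∘ₗ (repLift ρ).toLinearMap,
    fun x y => ?_, fun i j a => ?_⟩
  · simp [hfst]
  · simp [hρ]

/-! ### Evaluation of tensors on the representation space -/

/-- The evaluation `u ⊗ v ↦ u_{kj} v_{il}`. -/
def evalPair (K A : Type*) [Field K] [Ring A] [Algebra K A] {N : ℕ} (k j i l : Fin N) :
    A ⊗[K] A →ₗ[K] RepRing K A N :=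
  TensorProduct.lift ((LinearMap.mul K (RepRing K A N)).compl₁₂ (coord K A k j) (coord K A i l))

theorem evalPair_tmul (k j i l : Fin N) (u v : A) :
    evalPair K A k j i l (u ⊗ₜ v) = coord K A k j u * coord K A i l v := rfl

theorem evalPair_comm (k j i l : Fin N) (x : A ⊗[K] A) :
    evalPair K A k j i l (TensorProduct.comm K A A x) = evalPair K A i l k j x := by
  induction x with
  | zero => simp
  | add x y hx hy => simp only [map_add, hx, hy]
  | tmul u v => rw [TensorProduct.comm_tmul, evalPair_tmul, evalPair_tmul, mul_comm]

theorem evalPair_outer_left (k j i l : Fin N) (b : A) (x : A ⊗[K] A) :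
    evalPair K A k j i l ((b ⊗ₜ 1) * x) = ∑ r, coord K A k r b * evalPair K A r j i l x := by
  induction x with
  | zero => simp
  | add x y hx hy => simp only [mul_add, map_add, hx, hy, Finset.sum_add_distrib]
  | tmul u v =>
    simp [evalPair_tmul, coord_mul, Finset.sum_mul, mul_assoc]

theorem evalPair_inner_right (k j i l : Fin N) (b : A) (x : A ⊗[K] A) :
    evalPair K A k j i l (x * (b ⊗ₜ 1)) = ∑ r, coord K A r j b * evalPair K A k r i l x := by
  induction x with
  | zero => simp
  | add x y hx hy => simp only [add_mul, mul_add, map_add, hx, hy, Finset.sum_add_distrib]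
  | tmul u v =>
    simp only [Algebra.TensorProduct.tmul_mul_tmul, evalPair_tmul, coord_mul, Finset.sum_mul,
      mul_one]
    exact Finset.sum_congr rfl fun r _ => by ring

theorem evalPair_inner_left (k j i l : Fin N) (b : A) (x : A ⊗[K] A) :
    evalPair K A k j i l ((1 ⊗ₜ b) * x) = ∑ r, coord K A i r b * evalPair K A k j r l x := by
  rw [← evalPair_comm, comm_mul, TensorProduct.comm_tmul, evalPair_outer_left]
  simp only [evalPair_comm]

theorem evalPair_outer_right (k j i l : Fin N) (b : A) (x : A ⊗[K] A) :
    evalPair K A k j i l (x * (1 ⊗ₜ b)) = ∑ r, coord K A r l b * evalPair K A k j i r x := by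
  rw [← evalPair_comm, comm_mul, TensorProduct.comm_tmul, evalPair_inner_right]
  simp only [evalPair_comm]

/-- The evaluation `u ⊗ v ⊗ w ↦ u_{pj} v_{il} w_{kq}`. -/
def evalTriple (K A : Type*) [Field K] [Ring A] [Algebra K A] {N : ℕ} (p j i l k q : Fin N) :
    (A ⊗[K] A) ⊗[K] A →ₗ[K] RepRing K A N :=
  TensorProduct.lift ((LinearMap.mul K (RepRing K A N)).compl₁₂ (evalPair K A p j i l)
    (coord K A k q))

theorem evalTriple_tmul (p j i l k q : Fin N) (x : A ⊗[K] A) (w : A) :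
    evalTriple K A p j i l k q (x ⊗ₜ w) = evalPair K A p j i l x * coord K A k q w := rfl

theorem evalTriple_cyc (p j i l k q : Fin N) (x : (A ⊗[K] A) ⊗[K] A) :
    evalTriple K A p j i l k q (cyc K A x) = evalTriple K A i l k q p j x := by
  refine LinearMap.congr_fun (f := evalTriple K A p j i l k q ∘ₗ cyc K A)
    (TensorProduct.ext_threefold fun u v w => ?_) x
  simp only [LinearMap.comp_apply, cyc_tmul, evalTriple_tmul, evalPair_tmul]
  ring

/-! ### The induced bracket on the representation space -/

theorem exists_hamiltonian {D : BilinearToTensor K A} (h : IsDoubleBracket D) (a : A)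
    (i j : Fin N) :
    ∃ F : RepRing K A N →ₗ[K] RepRing K A N, (∀ x y, F (x * y) = x * F y + y * F x) ∧
      ∀ k l b, F (coord K A k l b) = evalPair K A k j i l (D a b) := by
  refine exists_repRing_derivation (M := RepRing K A N)
    (fun k l => evalPair K A k j i l ∘ₗ D a) fun k l b c => ?_
  simp only [LinearMap.comp_apply, h.derivation a b c, map_add, evalPair_outer_left,
    evalPair_outer_right, smul_eq_mul, Finset.sum_add_distrib]

/-- The derivations `{a_{ij}, -}` are themselves elements of the module of endomorphisms of the
coordinate ring. Applying `exists_repRing_derivation` to this module extends them in the first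
variable. -/
theorem exists_biderivation {D : BilinearToTensor K A} (h : IsDoubleBracket D) :
    ∃ B : RepRing K A N →ₗ[K] RepRing K A N →ₗ[K] RepRing K A N,
      (∀ x y z, B (x * y) z = x * B y z + B x z * y) ∧
      (∀ x y z, B x (y * z) = y * B x z + B x y * z) ∧
      ∀ a b i j k l, B (coord K A i j a) (coord K A k l b) = evalPair K A k j i l (D a b) := by
  choose F hF hFc using fun a i j => exists_hamiltonian (N := N) h a i j
  have hder : ∀ G : RepRing K A N →ₗ[K] RepRing K A N, (∀ x y, G (x * y) = x * G y + y * G x) →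
      (∀ i j a, G (coord K A i j a) = 0) → G = 0 := fun G hG =>
    repRing_derivation_eq_zero (AlgHom.id K _) G fun x y => by
      rw [hG, AlgHom.id_apply, AlgHom.id_apply, mul_comm y]
  let θ : Fin N → Fin N → A →ₗ[K] (RepRing K A N →ₗ[K] RepRing K A N) := fun i j =>
    { toFun := fun a => F a i j
      map_add' := fun a b => by
        rw [← sub_eq_zero]
        refine hder _ (fun x y => ?_) fun k l c => ?_
        · simp only [LinearMap.sub_apply, LinearMap.add_apply, hF]
          ring
        · simp [hFc]
      map_smul' := fun r a => by
        rw [← sub_eq_zero]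
        refine hder _ (fun x y => ?_) fun k l c => ?_
        · simp only [LinearMap.sub_apply, LinearMap.smul_apply, hF, RingHom.id_apply, smul_add,
            mul_sub, mul_smul_comm]
          ring
        · simp [hFc] }
  have hθ : ∀ i j a, θ i j a = F a i j := fun _ _ _ => rfl
  -- The required identity is one between derivations in the second variable, so it is tested on
  -- coordinates, where it is the inner Leibniz rule `mul_left`.
  obtain ⟨B, hB, hBc⟩ := exists_repRing_derivation θ fun i j a b => by
    rw [← sub_eq_zero]
    refine hder _ (fun x y => ?_) fun k l c => ?_
    · simp only [LinearMap.sub_apply, LinearMap.sum_apply, LinearMap.add_apply,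
        LinearMap.smul_apply, hθ, hF, smul_eq_mul, mul_sub, Finset.mul_sum]
      rw [sub_add_sub_comm, ← Finset.sum_add_distrib]
      congr 1
      exact Finset.sum_congr rfl fun r _ => by ring
    · simp only [LinearMap.sub_apply, LinearMap.sum_apply, LinearMap.add_apply,
        LinearMap.smul_apply, hθ, hFc, smul_eq_mul, h.mul_left, map_add, evalPair_inner_left,
        evalPair_inner_right, Finset.sum_add_distrib, sub_self]
  have hl : ∀ x y z, B (x * y) z = x * B y z + B x z * y := fun x y z => by
    rw [hB, mul_comm _ y]; rfl
  refine ⟨B, hl, fun x y z => ?_, fun a b i j k l => by rw [hBc, hθ, hFc]⟩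
  -- The failure of the Leibniz rule in the second variable is a derivation in the first, and it
  -- vanishes when the first variable is a coordinate.
  let G : RepRing K A N →ₗ[K] RepRing K A N := B.flip (y * z) -
    (LinearMap.mulLeft K y ∘ₗ B.flip z + LinearMap.mulRight K z ∘ₗ B.flip y)
  have hG : ∀ x, G x = B x (y * z) - (y * B x z + B x y * z) := fun _ => rfl
  have : G = 0 := hder G (fun x x' => by simp only [hG, hl]; ring) fun i j a => by
    rw [hG, hBc, hθ, hF]
    ring
  rw [← sub_eq_zero, ← hG, this, LinearMap.zero_apply]

section Poisson

variable {B : RepRing K A N →ₗ[K] RepRing K A N →ₗ[K] RepRing K A N}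

theorem IsPoissonBracket.leibniz_left (h : IsPoissonBracket B) (x y z : RepRing K A N) :
    B (x * y) z = x * B y z + B x z * y := by
  rw [h.antisymm, h.leibniz, h.antisymm y z, h.antisymm x z]
  ring

/-- The Jacobi expression of an antisymmetric biderivation is a derivation in its last argument and
cyclic, as in `jacobiator_eq_zero_of_adjoin_eq_top`. -/
theorem jacobi_of_coord (ha : ∀ x y, B x y = -B y x)
    (hL : ∀ x y z, B x (y * z) = y * B x z + B x y * z)
    (h0 : ∀ a b c i j k l p q,
      B (coord K A i j a) (B (coord K A k l b) (coord K A p q c)) +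
        B (coord K A k l b) (B (coord K A p q c) (coord K A i j a)) +
        B (coord K A p q c) (B (coord K A i j a) (coord K A k l b)) = 0)
    (x y z : RepRing K A N) : B x (B y z) + B y (B z x) + B z (B x y) = 0 := by
  let G : RepRing K A N → RepRing K A N → RepRing K A N →ₗ[K] RepRing K A N := fun x y =>
    B x ∘ₗ B y + B y ∘ₗ B.flip x + B.flip (B x y)
  have hG : ∀ x y z, G x y z = B x (B y z) + B y (B z x) + B z (B x y) := fun _ _ _ => rfl
  have hcyc : ∀ x y z, G x y z = G y z x := fun x y z => by rw [hG, hG]; abel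
  have key : ∀ x y, (∀ i j a, G x y (coord K A i j a) = 0) → G x y = 0 := fun x y =>
    repRing_derivation_eq_zero (AlgHom.id K _) (G x y) fun z w => by
      simp only [hG, AlgHom.id_apply, ha _ x, ha _ (B x y), hL, map_add, map_neg]
      ring
  have h1 : ∀ i j a k l b, G (coord K A i j a) (coord K A k l b) = 0 := fun i j a k l b =>
    key _ _ fun p q c => h0 a b c i j k l p q
  have h2 : ∀ i j a y, G y (coord K A i j a) = 0 := fun i j a y => key _ _ fun k l b => by
    rw [hcyc, h1, LinearMap.zero_apply]
  have h3 : G x y = 0 := key _ _ fun i j a => by rw [hcyc, h2, LinearMap.zero_apply]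
  rw [← hG, h3, LinearMap.zero_apply]

end Poisson

theorem bracket_evalPair {D : BilinearToTensor K A}
    {B : RepRing K A N →ₗ[K] RepRing K A N →ₗ[K] RepRing K A N}
    (hL : ∀ x y z, B x (y * z) = y * B x z + B x y * z)
    (hc : ∀ a b i j k l, B (coord K A i j a) (coord K A k l b) = evalPair K A k j i l (D a b))
    (a : A) (i j k l p q : Fin N) (x : A ⊗[K] A) :
    B (coord K A i j a) (evalPair K A p l k q x) =
      evalTriple K A p j i l k q ((D a).rTensor A x) +
        evalTriple K A k j i q p l ((D a).rTensor A (TensorProduct.comm K A A x)) := by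
  induction x with
  | zero => simp
  | add x y hx hy => simp only [map_add, hx, hy]; abel
  | tmul u v =>
    simp only [evalPair_tmul, hL, hc, TensorProduct.comm_tmul, LinearMap.rTensor_tmul,
      evalTriple_tmul]
    ring

theorem exists_isInducedOnRep {D : BilinearToTensor K A} (hD : IsDoublePoissonBracket D) :
    ∃ B : RepRing K A N →ₗ[K] RepRing K A N →ₗ[K] RepRing K A N, IsInducedOnRep D B := by
  obtain ⟨B, hl, hr, hc⟩ := exists_biderivation (N := N) hD.isDoubleBracket
  have ha : ∀ x y, B x y = -B y x := fun x y => by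
    have : B + B.flip = 0 := by
      refine repRing_biderivation_eq_zero (AlgHom.id K _) _ (fun x y z => ?_) (fun x y z => ?_)
        fun i j a k l b => ?_
      · simp only [LinearMap.add_apply, LinearMap.flip_apply, hl, hr, AlgHom.id_apply]
        ring
      · simp only [LinearMap.add_apply, LinearMap.flip_apply, hl, hr, AlgHom.id_apply]
        ring
      · rw [LinearMap.add_apply, LinearMap.add_apply, LinearMap.flip_apply, hc, hc,
          hD.antisymm a b, map_neg, evalPair_comm, neg_add_cancel]
    rw [eq_neg_iff_add_eq_zero]
    exact LinearMap.congr_fun (LinearMap.congr_fun this x) y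
  refine ⟨B, ⟨ha, hr, jacobi_of_coord ha hr fun a b c i j k l p q => ?_⟩, fun a b i j k l =>
    hc a b i j k l⟩
  -- The inner bracket is a product, so the outer one acts on either leg; antisymmetry turns the
  -- second contribution into minus a nested bracket with `b` and `c` exchanged. The Jacobi sum is
  -- thus an evaluation of `⦃a, b, c⦄` minus one of `⦃a, c, b⦄`.
  have key : ∀ a b c (i j k l p q : Fin N),
      B (coord K A i j a) (B (coord K A k l b) (coord K A p q c)) =
        evalTriple K A p j i l k q (nested D a b c) -
          evalTriple K A k j i q p l (nested D a c b) := fun a b c i j k l p q => by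
    have : TensorProduct.comm K A A (D b c) = -D c b := by
      rw [hD.antisymm c b, neg_neg]
    rw [hc, bracket_evalPair hr hc, this, map_neg, map_neg, sub_eq_add_neg]
    rfl
  have h1 := congrArg (evalTriple K A p j i l k q) (hD.jacobi a b c)
  have h2 := congrArg (evalTriple K A k j i q p l) (hD.jacobi a c b)
  simp only [map_add, evalTriple_cyc, map_zero] at h1 h2
  rw [key, key, key]
  linear_combination h1 - h2

theorem IsInducedOnRep.unique {D : BilinearToTensor K A}
    {B B' : RepRing K A N →ₗ[K] RepRing K A N →ₗ[K] RepRing K A N}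
    (h : IsInducedOnRep D B) (h' : IsInducedOnRep D B') : B = B' := by
  rw [← sub_eq_zero]
  refine repRing_biderivation_eq_zero (AlgHom.id K _) _ (fun x y z => ?_) (fun x y z => ?_)
    fun i j a k l b => ?_
  · simp only [LinearMap.sub_apply, h.poisson.leibniz_left, h'.poisson.leibniz_left,
      AlgHom.id_apply]
    ring
  · simp only [LinearMap.sub_apply, h.poisson.leibniz, h'.poisson.leibniz, AlgHom.id_apply]
    ring
  · rw [LinearMap.sub_apply, LinearMap.sub_apply, h.coord, h'.coord, sub_self]

/-! ### The restriction to invariants -/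

theorem conj_coord (g : GL (Fin N) K) (i j : Fin N) (a : A) :
    conj K A g (coord K A i j a) =
      ∑ t, ∑ s, (g i s * (g⁻¹ : GL (Fin N) K) t j) • coord K A s t a := by
  have h : conj K A g (coord K A i j a) =
      ((Algebra.ofId K (RepRing K A N)).mapMatrix (m := Fin N) g * univRep K A N a *
        (Algebra.ofId K (RepRing K A N)).mapMatrix (m := Fin N) (g⁻¹ : GL (Fin N) K)) i j :=
    repLift_coord _ a i j
  rw [h, Matrix.mul_apply]
  refine Finset.sum_congr rfl fun t _ => ?_
  rw [Matrix.mul_apply, Finset.sum_mul]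
  refine Finset.sum_congr rfl fun s _ => ?_
  change algebraMap K (RepRing K A N) (g i s) * coord K A s t a *
    algebraMap K (RepRing K A N) ((g⁻¹ : GL (Fin N) K) t j) = _
  rw [Algebra.smul_def (R := K) (A := RepRing K A N), map_mul]
  ring

theorem conj_evalPair (g : GL (Fin N) K) (k j i l : Fin N) (x : A ⊗[K] A) :
    conj K A g (evalPair K A k j i l x) =
      ∑ t', ∑ s', ∑ t, ∑ s, ((g k s * (g⁻¹ : GL (Fin N) K) t j) *
        (g i s' * (g⁻¹ : GL (Fin N) K) t' l)) • evalPair K A s t s' t' x := by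
  induction x with
  | zero => simp
  | add x y hx hy => simp only [map_add, hx, hy, smul_add, Finset.sum_add_distrib]
  | tmul u v =>
    simp only [evalPair_tmul, map_mul, conj_coord, Finset.sum_mul, Finset.mul_sum,
      smul_mul_smul_comm]

/-- The bracket of coordinates permutes row indices among themselves and column indices among
themselves. Rows transform by `g` and columns by `g⁻¹`, so equivariance holds on coordinates. -/
theorem IsInducedOnRep.conj_bracket {D : BilinearToTensor K A}
    {B : RepRing K A N →ₗ[K] RepRing K A N →ₗ[K] RepRing K A N} (h : IsInducedOnRep D B)
    (g : GL (Fin N) K) (x y : RepRing K A N) :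
    conj K A g (B x y) = B (conj K A g x) (conj K A g y) := by
  have hc : ∀ a b i j k l, B (DoublePoisson.coord K A i j a) (DoublePoisson.coord K A k l b) =
      evalPair K A k j i l (D a b) := h.coord
  have key : B.compr₂ (conj K A g).toLinearMap -
      B.compl₁₂ (conj K A g).toLinearMap (conj K A g).toLinearMap = 0 := by
    refine repRing_biderivation_eq_zero (conj K A g) _ (fun x y z => ?_) (fun x y z => ?_)
      fun i j a k l b => ?_
    · simp only [LinearMap.sub_apply, LinearMap.compr₂_apply, LinearMap.compl₁₂_apply,
        AlgHom.toLinearMap_apply, h.poisson.leibniz_left, map_mul, map_add]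
      ring
    · simp only [LinearMap.sub_apply, LinearMap.compr₂_apply, LinearMap.compl₁₂_apply,
        AlgHom.toLinearMap_apply, h.poisson.leibniz, map_mul, map_add]
      ring
    · simp only [LinearMap.sub_apply, LinearMap.compr₂_apply, LinearMap.compl₁₂_apply,
        AlgHom.toLinearMap_apply, hc, conj_evalPair, conj_coord, map_sum, map_smul,
        LinearMap.sum_apply, LinearMap.smul_apply, Finset.smul_sum, smul_smul]
      rw [sub_eq_zero]
      -- Both sides are the same fourfold sum, up to the order of summation and of the scalars.
      refine Finset.sum_congr rfl fun t' _ => ?_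
      rw [Finset.sum_comm, Finset.sum_comm (s := Finset.univ) (t := Finset.univ)
        (f := fun s t => ∑ s', (g k s * (g⁻¹ : GL (Fin N) K) t' l *
          (g i s' * (g⁻¹ : GL (Fin N) K) t j)) • evalPair K A s t s' t' (D a b))]
      refine Finset.sum_congr rfl fun t _ => ?_
      rw [Finset.sum_comm]
      refine Finset.sum_congr rfl fun s _ => Finset.sum_congr rfl fun s' _ => ?_
      congr 1
      ring
  rw [← sub_eq_zero]
  exact LinearMap.congr_fun (LinearMap.congr_fun key x) y

theorem mem_issRing {x : RepRing K A N} : x ∈ issRing K A N ↔ ∀ g, conj K A g x = x := by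
  simp [issRing, Algebra.mem_iInf, AlgHom.mem_equalizer]

theorem IsInducedOnRep.existsUnique_restriction {D : BilinearToTensor K A}
    {B : RepRing K A N →ₗ[K] RepRing K A N →ₗ[K] RepRing K A N} (h : IsInducedOnRep D B) :
    ∃! B' : issRing K A N →ₗ[K] issRing K A N →ₗ[K] issRing K A N, IsRestrictionToIss B B' := by
  have hmem : ∀ x y : issRing K A N, B x y ∈ issRing K A N := fun x y =>
    mem_issRing.2 fun g => by
      rw [h.conj_bracket, mem_issRing.1 x.2, mem_issRing.1 y.2]
  refine ⟨LinearMap.mk₂ K (fun x y => ⟨B x y, hmem x y⟩) ?_ ?_ ?_ ?_, ⟨⟨?_, ?_, ?_⟩, ?_⟩, ?_⟩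
  · exact fun x y z => Subtype.ext (by simp)
  · exact fun r x y => Subtype.ext (by simp)
  · exact fun x y z => Subtype.ext (by simp)
  · exact fun r x y => Subtype.ext (by simp)
  · exact fun x y => Subtype.ext (h.poisson.antisymm x y)
  · exact fun x y z => Subtype.ext (h.poisson.leibniz x y z)
  · exact fun x y z => Subtype.ext (h.poisson.jacobi x y z)
  · exact fun x y => rfl
  · exact fun B' hB' => LinearMap.ext fun x => LinearMap.ext fun y =>
      Subtype.ext (hB'.restrict x y)

/-! ### Traces -/

/-- The trace `a ↦ tr(a)` as a linear map to the coordinate ring of the representation space. -/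
def traceₗ (K A : Type*) [Field K] [Ring A] [Algebra K A] (N : ℕ) : A →ₗ[K] RepRing K A N :=
  Matrix.traceLinearMap (Fin N) K (RepRing K A N) ∘ₗ (univRep K A N).toLinearMap

theorem traceₗ_apply (a : A) : traceₗ K A N a = ∑ i, coord K A i i a := rfl

theorem traceₗ_mul_comm (a b : A) : traceₗ K A N (a * b) = traceₗ K A N (b * a) := by
  change (univRep K A N (a * b)).trace = (univRep K A N (b * a)).trace
  rw [map_mul, map_mul, Matrix.trace_mul_comm]

theorem IsInducedOnRep.bracket_traceₗ {D : BilinearToTensor K A}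
    {B : RepRing K A N →ₗ[K] RepRing K A N →ₗ[K] RepRing K A N} (h : IsInducedOnRep D B)
    (a b : A) : B (traceₗ K A N a) (traceₗ K A N b) =
      traceₗ K A N (LinearMap.mul' K A (D a b)) := by
  have hc : ∀ a b i j k l, B (DoublePoisson.coord K A i j a) (DoublePoisson.coord K A k l b) =
      evalPair K A k j i l (D a b) := h.coord
  simp only [traceₗ_apply, map_sum, LinearMap.sum_apply, hc]
  induction D a b with
  | zero => simp
  | add x y hx hy => simp only [map_add, Finset.sum_add_distrib, hx, hy]
  | tmul u v => simp only [evalPair_tmul, LinearMap.mul'_apply, coord_mul]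

end Rep

section Words

variable {K A : Type*} [Field K] [Ring A] [Algebra K A]

/-! ### Double brackets of products of letters -/

theorem IsDoubleDer.apply_prod {δ : A →ₗ[K] A ⊗[K] A} (h : IsDoubleDer δ) (w : List A) :
    δ w.prod = ∑ s ∈ Finset.range w.length,
      ((w.take s).prod ⊗ₜ 1) * δ (w.getD s 0) * (1 ⊗ₜ (w.drop (s + 1)).prod) := by
  induction w with
  | nil => simpa using h.map_one
  | cons a w ih =>
    have h1 : ∀ b c : A, (b * c) ⊗ₜ[K] (1 : A) = (b ⊗ₜ 1) * (c ⊗ₜ 1) := by simp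
    rw [List.prod_cons, h, ih, List.length_cons, Finset.sum_range_succ', Finset.mul_sum]
    congr 1
    · refine Finset.sum_congr rfl fun s _ => ?_
      rw [List.take_succ_cons, List.prod_cons, h1, List.getD_cons_succ, List.drop_succ_cons]
      simp only [mul_assoc]
    · rw [List.take_zero, List.prod_nil, ← Algebra.TensorProduct.one_def, one_mul,
        List.getD_cons_zero, List.drop_succ_cons, List.drop_zero]

theorem IsDoubleBracket.prod_left {D : BilinearToTensor K A} (h : IsDoubleBracket D)
    (w : List A) (b : A) :
    D w.prod b = ∑ r ∈ Finset.range w.length,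
      (1 ⊗ₜ (w.take r).prod) * D (w.getD r 0) b * ((w.drop (r + 1)).prod ⊗ₜ 1) := by
  rw [h.antisymm, (h.derivation b).apply_prod, map_sum, ← Finset.sum_neg_distrib]
  refine Finset.sum_congr rfl fun r _ => ?_
  rw [comm_mul, comm_mul, TensorProduct.comm_tmul, TensorProduct.comm_tmul,
    h.antisymm (w.getD r 0) b]
  noncomm_ring

theorem IsDoubleBracket.prod_prod {D : BilinearToTensor K A} (h : IsDoubleBracket D)
    (v w : List A) :
    D v.prod w.prod = ∑ r ∈ Finset.range v.length, ∑ s ∈ Finset.range w.length,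
      ((w.take s).prod ⊗ₜ (v.take r).prod) * D (v.getD r 0) (w.getD s 0) *
        ((v.drop (r + 1)).prod ⊗ₜ (w.drop (s + 1)).prod) := by
  rw [h.prod_left]
  refine Finset.sum_congr rfl fun r _ => ?_
  rw [(h.derivation _).apply_prod, Finset.mul_sum, Finset.sum_mul]
  refine Finset.sum_congr rfl fun s _ => ?_
  have h1 : ∀ b c : A, b ⊗ₜ[K] c = (1 ⊗ₜ c) * (b ⊗ₜ 1) := by simp
  rw [h1 (w.take s).prod (v.take r).prod, h1 (v.drop (r + 1)).prod (w.drop (s + 1)).prod]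
  simp only [mul_assoc]

theorem splice_smul (x y : List A) (a b : ℕ) (k : K) (u : A) :
    splice K x y a b (k • u) = k • splice K x y a b u := by
  simp [splice, smul_sub, TensorProduct.smul_tmul']

theorem prod_drop_eq (w : List A) {r : ℕ} (hr : r < w.length) :
    (w.drop r).prod = w.getD r 0 * (w.drop (r + 1)).prod := by
  rw [List.drop_eq_getElem_cons hr, List.prod_cons, List.getD_eq_getElem _ _ hr]

theorem prod_take_succ_eq (w : List A) {r : ℕ} (hr : r < w.length) :
    (w.take (r + 1)).prod = (w.take r).prod * w.getD r 0 := by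
  rw [List.prod_take_succ _ _ hr, List.getD_eq_getElem _ _ hr]

/-- A splice is a letter bracket of the form `x_r ⊗ u - u ⊗ x_r`, surrounded as in the Leibniz
expansion `prod_prod`. The letter of `y` at position `s` does not occur, so only `r` needs a bound.
-/
theorem splice_eq (x y : List A) {r s : ℕ} (hr : r < x.length) (u : A) :
    splice K x y r s u = ((y.take s).prod ⊗ₜ (x.take r).prod) *
      (x.getD r 0 ⊗ₜ u - u ⊗ₜ x.getD r 0) *
        ((x.drop (r + 1)).prod ⊗ₜ (y.drop (s + 1)).prod) := by
  rw [splice, prod_drop_eq x hr, prod_take_succ_eq x hr]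
  simp [mul_sub, sub_mul, mul_assoc]

theorem rot_eq {w : List A} {r : ℕ} (hr : r ≤ w.length) :
    rot r w = (w.drop r).prod * (w.take r).prod := by
  rw [rot, List.rotate_eq_drop_append_take hr, List.prod_append]

/-- Cyclicity of `τ` moves the initial part of `y` to the end. In the first term `u` then opens the
rotation of the modified `y`, in the second it closes it, whence the shift by one. -/
theorem trace_splice {V : Type*} [AddCommGroup V] [Module K V] (τ : A →ₗ[K] V)
    (hτ : ∀ a b, τ (a * b) = τ (b * a)) (x y : List A) {r s : ℕ} (hr : r < x.length)
    (hs : s < y.length) (u : A) :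
    τ (LinearMap.mul' K A (splice K x y r s u)) =
      τ (rot r x * rot s (y.set s u)) - τ (rot (r + 1) x * rot (s + 1) (y.set s u)) := by
  have hs' : s < (y.set s u).length := by simpa using hs
  have ht : (y.set s u).take s = y.take s := List.take_set_of_le le_rfl
  have hd : (y.set s u).drop (s + 1) = y.drop (s + 1) :=
    List.drop_set_of_lt (Nat.lt_succ_self s)
  have hg : (y.set s u).getD s 0 = u := by
    rw [List.getD_eq_getElem _ _ hs', List.getElem_set_self]
  rw [rot_eq hr.le, rot_eq hs'.le, rot_eq hr, rot_eq hs', prod_drop_eq _ hs',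
    prod_take_succ_eq _ hs', ht, hd, hg, splice, map_sub, map_sub, LinearMap.mul'_apply,
    LinearMap.mul'_apply]
  congr 1
  · rw [mul_assoc (y.take s).prod, hτ]
    simp only [mul_assoc]
  · rw [mul_assoc (y.take s).prod, mul_assoc (y.take s).prod, hτ, mul_assoc u, mul_assoc u, hτ]
    simp only [mul_assoc]

theorem trace_splice_self {V : Type*} [AddCommGroup V] [Module K V] (τ : A →ₗ[K] V)
    (hτ : ∀ a b, τ (a * b) = τ (b * a)) (x y : List A) {r s : ℕ} (hr : r < x.length)
    (hs : s < y.length) :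
    τ (LinearMap.mul' K A (splice K x y r s (y.getD s 0))) =
      τ (rot r x * rot s y) - τ (rot (r + 1) x * rot (s + 1) y) := by
  rw [trace_splice τ hτ x y hr hs, List.getD_eq_getElem _ _ hs, List.set_getElem_self]

theorem sum_range_two_mul {M : Type*} [AddCommMonoid M] (g : ℕ → M) (p : ℕ) :
    ∑ r ∈ Finset.range (2 * p), g r = ∑ l : Fin p, (g (2 * l) + g (2 * l + 1)) := by
  rw [Fin.sum_univ_eq_sum_range (fun l => g (2 * l) + g (2 * l + 1))]
  induction p with
  | zero => simp
  | succ p ih =>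
    rw [mul_add, mul_one, Finset.sum_range_succ, Finset.sum_range_succ, ih,
      Finset.sum_range_succ, add_assoc]

theorem rot_finRotate {w : List A} {p : ℕ} (hw : w.length = 2 * p) (l : Fin p) :
    rot (2 * (finRotate p l : ℕ)) w = rot (2 * l + 2) w := by
  obtain _ | p := p
  · exact l.elim0
  -- Rotation depends only on the amount modulo the length; at the last position `2 * l + 2` is the
  -- full length and wraps to `0`.
  · rw [rot, rot, ← List.rotate_mod w (2 * l + 2), hw]
    congr 2
    rw [finRotate_apply, Fin.val_add_one]
    split_ifs with h
    · subst h
      simp [mul_add]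
    · have : (l : ℕ) ≠ p := fun h' => h (Fin.ext h')
      rw [Nat.mod_eq_of_lt (by omega)]
      ring

end Words

/-! ### Brackets of idempotents and of words. -/

section Letters

variable {K : Type*} [Field K] {n m : ℕ}

theorem length_word {p : ℕ} (i : Fin p → Fin n) (i' : Fin p → Fin m) :
    (word K i i').length = 2 * p := by
  simp [word, mul_comm, Function.comp_def]

theorem word_succ {p : ℕ} (i : Fin (p + 1) → Fin n) (i' : Fin (p + 1) → Fin m) :
    word K i i' = e K m (i 0) :: f K n (i' 0) :: word K (fun l => i l.succ) fun l => i' l.succ := by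
  simp [word, List.ofFn_succ]

theorem word_getD {p : ℕ} (i : Fin p → Fin n) (i' : Fin p → Fin m) (l : Fin p) :
    (word K i i').getD (2 * l) 0 = e K m (i l) ∧
      (word K i i').getD (2 * l + 1) 0 = f K n (i' l) := by
  induction p with
  | zero => exact l.elim0
  | succ p ih =>
    rw [word_succ]
    induction l using Fin.cases with
    | zero => simp
    | succ l => simpa [mul_add] using ih (fun l => i l.succ) (fun l => i' l.succ) l

theorem tensor_sub_smul (r s : K) (x : (Fin n → K) ⊗[K] (Fin n → K)) :
    (r - s) • x = r • x - s • x :=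
  sub_smul r s x

theorem arrow_single (i j k : Fin n) :
    arrow K i j (Pi.single k 1) = ((if i = k then 1 else 0) - (if j = k then 1 else 0) : K) •
      ((Pi.single j (1 : K) : Fin n → K) ⊗ₜ[K] (Pi.single i (1 : K) : Fin n → K)) := by
  have h : ∀ i : Fin n, (Pi.single i (1 : K) : Fin n → K) * Pi.single k 1 =
      (if i = k then (1 : K) else 0) • Pi.single i 1 := fun i => by
    by_cases hik : i = k
    · subst hik
      rw [← Pi.single_mul, if_pos rfl, one_smul, mul_one]
    · rw [if_neg hik, zero_smul, ← Pi.single_mul_left, Pi.single_eq_of_ne hik, mul_zero,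
        Pi.single_zero]
  have h1 : arrow K i j (Pi.single k 1) =
      (Pi.single j (1 : K) : Fin n → K) ⊗ₜ[K]
        ((Pi.single i (1 : K) : Fin n → K) * Pi.single k 1) -
      ((Pi.single k (1 : K) : Fin n → K) * Pi.single j (1 : K)) ⊗ₜ[K]
        (Pi.single i (1 : K) : Fin n → K) := by
    simp [arrow, innerDoubleDer]
  rw [h1, mul_comm (Pi.single k (1 : K) : Fin n → K), h, h, TensorProduct.tmul_smul,
    ← TensorProduct.smul_tmul', tensor_sub_smul]

/-- `e_i ⊗ e_j - e_j ⊗ e_i`. -/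
def wedge (K : Type*) [Field K] {n : ℕ} (i j : Fin n) : (Fin n → K) ⊗[K] (Fin n → K) :=
  (Pi.single i (1 : K) : Fin n → K) ⊗ₜ (Pi.single j (1 : K) : Fin n → K) -
    (Pi.single j (1 : K) : Fin n → K) ⊗ₜ (Pi.single i (1 : K) : Fin n → K)

theorem wedge_swap (i j : Fin n) : wedge K i j = -wedge K j i := by
  simp [wedge]

theorem bracketOfPair_arrow (i j k l : Fin n) :
    bracketOfPair (arrow K i j) (arrow K j i) (Pi.single k 1) (Pi.single l 1) =
      (((if i = k then 1 else 0) - (if j = k then 1 else 0)) *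
        ((if j = l then 1 else 0) - (if i = l then 1 else 0)) : K) • wedge K i j := by
  have h : ∀ i : Fin n, (Pi.single i (1 : K) : Fin n → K) * Pi.single i 1 = Pi.single i 1 :=
    fun i => by rw [← Pi.single_mul, mul_one]
  simp only [bracketOfPair_apply, arrow_single, map_smul, LinearMap.smul_apply, interlace_tmul, h,
    smul_smul, wedge, smul_sub]
  congr 2 <;> ring

/-- Expanding the product of differences of Kronecker deltas gives four sums. Those with `{i, j} =
{k, l}` combine to `c̄_{kl}`; the other two survive only for `k = l` and combine to the sum over
`s`, whose term `s = k` is zero. -/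
theorem tensorBracket_single (c : Fin n → Fin n → K) (k l : Fin n) :
    tensorBracket c (Pi.single k 1) (Pi.single l 1) =
      if l = k then -∑ s with s ≠ k, bar c k s • wedge K k s else bar c k l • wedge K k l := by
  have hw : ∀ i : Fin n, wedge K i i = 0 := fun i => sub_self _
  have key : tensorBracket c (Pi.single k 1) (Pi.single l 1) =
      bar c k l • wedge K k l - if l = k then ∑ s, bar c k s • wedge K k s else 0 := by
    have hterm : ∀ i j, c i j • bracketOfPair (arrow K i j) (arrow K j i) (Pi.single k 1)
        (Pi.single l 1) = (if i = k then if j = l then c i j • wedge K i j else 0 else 0) -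
          (if i = k then if i = l then c i j • wedge K i j else 0 else 0) -
          (if j = k then if j = l then c i j • wedge K i j else 0 else 0) +
          (if j = k then if i = l then c i j • wedge K i j else 0 else 0) := fun i j => by
      rw [bracketOfPair_arrow, smul_smul]
      split_ifs <;> module
    simp only [tensorBracket_apply, hterm, Finset.sum_add_distrib, Finset.sum_sub_distrib,
      Finset.sum_ite_irrel, Finset.sum_const_zero, Finset.sum_ite_eq', Finset.mem_univ, if_true]
    rw [wedge_swap l k]
    simp only [wedge_swap _ k, bar, tensor_sub_smul, Finset.sum_sub_distrib, eq_comm (a := l)]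
    split_ifs with h
    · simp
      abel
    · simp
      abel
  rw [key]
  split_ifs with h
  · subst h
    rw [hw, smul_zero, zero_sub, Finset.sum_filter]
    refine congrArg _ (Finset.sum_congr rfl fun s _ => ?_)
    split_ifs with hs
    · rfl
    · rw [not_not.1 hs, hw, smul_zero]
  · rw [sub_zero]

/-- The element `u` with `⦃e_k, e_l⦄ = e_k ⊗ u - u ⊗ e_k`, for a homomorphism out of `K^n`. -/
def letterPartner {A : Type*} [Ring A] [Algebra K A] (ι : (Fin n → K) →ₐ[K] A)
    (c : Fin n → Fin n → K) (k l : Fin n) : A :=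
  if l = k then -∑ s with s ≠ l, bar c l s • ι (Pi.single s 1) else bar c k l • ι (Pi.single l 1)

/-- For `l = k` all wedges share the factor `e_k`, so the sum collects in the other slot; this is
the origin of `ē` and `f̄`. -/
theorem map_tensorBracket_single {A : Type*} [Ring A] [Algebra K A] (ι : (Fin n → K) →ₐ[K] A)
    (c : Fin n → Fin n → K) (k l : Fin n) :
    TensorProduct.map ι.toLinearMap ι.toLinearMap
        (tensorBracket c (Pi.single k 1) (Pi.single l 1)) =
      ι (Pi.single k 1) ⊗ₜ letterPartner ι c k l - letterPartner ι c k l ⊗ₜ ι (Pi.single k 1) := by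
  have hw : ∀ i j, TensorProduct.map ι.toLinearMap ι.toLinearMap (wedge K i j) =
      ι (Pi.single i 1) ⊗ₜ ι (Pi.single j 1) - ι (Pi.single j 1) ⊗ₜ ι (Pi.single i 1) :=
    fun i j => by simp [wedge]
  rw [tensorBracket_single, letterPartner]
  split_ifs with h
  · subst h
    simp only [map_neg, map_sum, map_smul, hw, TensorProduct.tmul_neg, TensorProduct.neg_tmul,
      TensorProduct.tmul_sum, TensorProduct.sum_tmul, TensorProduct.tmul_smul, smul_sub,
      TensorProduct.smul_tmul', Finset.sum_sub_distrib]
    abel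
  · simp only [map_smul, hw, TensorProduct.tmul_smul, smul_sub, TensorProduct.smul_tmul']

/-- Letters of different factors bracket to zero, so only pairs of positions of equal parity
contribute: even ones carry `e`, odd ones `f`. -/
theorem IsInducedDoubleBracket.apply_word {c : Fin n → Fin n → K} {d : Fin m → Fin m → K}
    {D : BilinearToTensor K (FreeProd K n m)} (h : IsInducedDoubleBracket c d D) {p q : ℕ}
    (i : Fin p → Fin n) (i' : Fin p → Fin m) (j : Fin q → Fin n) (j' : Fin q → Fin m) :
    D (word K i i').prod (word K j j').prod = ∑ l : Fin p, ∑ k : Fin q,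
      (splice K (word K i i') (word K j j') (2 * l) (2 * k)
          (letterPartner (inl K n m) c (i l) (j k)) +
        splice K (word K i i') (word K j j') (2 * l + 1) (2 * k + 1)
          (letterPartner (inr K n m) d (i' l) (j' k))) := by
  rw [h.poisson.isDoubleBracket.prod_prod, length_word, length_word, sum_range_two_mul]
  refine Finset.sum_congr rfl fun l _ => ?_
  rw [sum_range_two_mul, sum_range_two_mul, ← Finset.sum_add_distrib]
  refine Finset.sum_congr rfl fun k _ => ?_
  have hl := l.2
  rw [splice_eq _ _ (by rw [length_word]; omega), splice_eq _ _ (by rw [length_word]; omega),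
    (word_getD i i' l).1, (word_getD i i' l).2, (word_getD j j' k).1, (word_getD j j' k).2,
    e, e, f, f, h.left, h.right, h.mixed, h.mixed', map_tensorBracket_single,
    map_tensorBracket_single]
  simp only [mul_zero, zero_mul, add_zero, zero_add]

theorem letterPartner_inl (c : Fin n → Fin n → K) (k l : Fin n) :
    letterPartner (inl K n m) c k l = if l = k then eBar m c l else bar c k l • e K m l := rfl

theorem letterPartner_inr (d : Fin m → Fin m → K) (k l : Fin m) :
    letterPartner (inr K n m) d k l = if l = k then fBar n d l else bar d k l • f K n l := rfl

theorem sum_apply_ite_smul {V ι : Type*} [AddCommGroup V] [Module K V] [Fintype ι]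
    {A : Type*} [Ring A] [Algebra K A] (P : ι → Prop) [DecidablePred P] (F : ι → A → V)
    (b : ι → K) (hF : ∀ k (r : K) u, F k (r • u) = r • F k u) (u v : ι → A) :
    ∑ k, F k (if P k then u k else b k • v k) =
      (∑ k with ¬ P k, b k • F k (v k)) + ∑ k with P k, F k (u k) := by
  rw [Finset.sum_filter, Finset.sum_filter, ← Finset.sum_add_distrib]
  refine Finset.sum_congr rfl fun k _ => ?_
  by_cases h : P k <;> simp [h, hF]

theorem IsInducedDoubleBracket.apply_word_eq {c : Fin n → Fin n → K} {d : Fin m → Fin m → K}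
    {D : BilinearToTensor K (FreeProd K n m)} (h : IsInducedDoubleBracket c d D) {p q : ℕ}
    (i : Fin p → Fin n) (i' : Fin p → Fin m) (j : Fin q → Fin n) (j' : Fin q → Fin m) :
    D (word K i i').prod (word K j j').prod =
      ∑ l : Fin p,
        ((∑ k with j' k ≠ i' l, bar d (i' l) (j' k) •
            splice K (word K i i') (word K j j') (2 * l + 1) (2 * k + 1) (f K n (j' k))) +
          (∑ k with j k ≠ i l, bar c (i l) (j k) •
            splice K (word K i i') (word K j j') (2 * l) (2 * k) (e K m (j k))) +
          (∑ k with j' k = i' l,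
            splice K (word K i i') (word K j j') (2 * l + 1) (2 * k + 1) (fBar n d (j' k))) +
          ∑ k with j k = i l,
            splice K (word K i i') (word K j j') (2 * l) (2 * k) (eBar m c (j k))) := by
  rw [h.apply_word]
  refine Finset.sum_congr rfl fun l _ => ?_
  simp only [Finset.sum_add_distrib, letterPartner_inl, letterPartner_inr]
  rw [sum_apply_ite_smul (fun k => j k = i l)
      (fun k => splice K (word K i i') (word K j j') (2 * l) (2 * k)) _
      (fun k => splice_smul _ _ _ _),
    sum_apply_ite_smul (fun k => j' k = i' l)
      (fun k => splice K (word K i i') (word K j j') (2 * l + 1) (2 * k + 1)) _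
      (fun k => splice_smul _ _ _ _)]
  abel

/-- The trace of the double bracket of two words. -/
theorem IsInducedDoubleBracket.trace_apply_word {c : Fin n → Fin n → K} {d : Fin m → Fin m → K}
    {D : BilinearToTensor K (FreeProd K n m)} (h : IsInducedDoubleBracket c d D)
    {V : Type*} [AddCommGroup V] [Module K V] (τ : FreeProd K n m →ₗ[K] V)
    (hτ : ∀ a b, τ (a * b) = τ (b * a)) {p q : ℕ}
    (i : Fin p → Fin n) (i' : Fin p → Fin m) (j : Fin q → Fin n) (j' : Fin q → Fin m)
    (x y : List (FreeProd K n m)) (hx : x = word K i i') (hy : y = word K j j') :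
    τ (LinearMap.mul' K _ (D x.prod y.prod)) =
      ∑ l : Fin p,
        (τ (rot (2 * l + 1) x *
            ((∑ k with j' k ≠ i' l, bar d (i' l) (j' k) • rot (2 * k + 1) y) -
              ∑ k with j k ≠ i l, bar c (i l) (j k) • rot (2 * k + 1) y)) -
          τ (rot (2 * l + 2) x *
            ((∑ k with j' k ≠ i' l, bar d (i' l) (j' k) • rot (2 * k + 2) y) -
              ∑ k with j (finRotate q k) ≠ i (finRotate p l),
                bar c (i (finRotate p l)) (j (finRotate q k)) • rot (2 * k + 2) y)) +
          (∑ k with j' k = i' l,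
            (τ (rot (2 * l + 1) x * rot (2 * k + 1) (y.set (2 * k + 1) (fBar n d (j' k)))) -
              τ (rot (2 * l + 2) x * rot (2 * k + 2) (y.set (2 * k + 1) (fBar n d (j' k)))))) +
          ∑ k with j k = i l,
            (τ (rot (2 * l) x * rot (2 * k) (y.set (2 * k) (eBar m c (j k)))) -
              τ (rot (2 * l + 1) x * rot (2 * k + 1) (y.set (2 * k) (eBar m c (j k)))))) := by
  have lx : x.length = 2 * p := hx ▸ length_word i i'
  have ly : y.length = 2 * q := hy ▸ length_word j j'
  have he : ∀ k : Fin q, e K m (j k) = y.getD (2 * k) 0 := fun k =>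
    hy ▸ (word_getD j j' k).1.symm
  have hf : ∀ k : Fin q, f K n (j' k) = y.getD (2 * k + 1) 0 := fun k =>
    hy ▸ (word_getD j j' k).2.symm
  have b0 : ∀ {p : ℕ} (l : Fin p), 2 * (l : ℕ) < 2 * p := fun l => by have := l.2; omega
  have b1 : ∀ {p : ℕ} (l : Fin p), 2 * (l : ℕ) + 1 < 2 * p := fun l => by have := l.2; omega
  have t1 : ∀ (l : Fin p) (k : Fin q) u,
      τ (LinearMap.mul' K _ (splice K x y (2 * l + 1) (2 * k + 1) u)) =
        τ (rot (2 * l + 1) x * rot (2 * k + 1) (y.set (2 * k + 1) u)) -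
          τ (rot (2 * l + 2) x * rot (2 * k + 2) (y.set (2 * k + 1) u)) := fun l k u =>
    trace_splice τ hτ x y (lx ▸ b1 l) (ly ▸ b1 k) u
  have t0 : ∀ (l : Fin p) (k : Fin q) u,
      τ (LinearMap.mul' K _ (splice K x y (2 * l) (2 * k) u)) =
        τ (rot (2 * l) x * rot (2 * k) (y.set (2 * k) u)) -
          τ (rot (2 * l + 1) x * rot (2 * k + 1) (y.set (2 * k) u)) := fun l k u =>
    trace_splice τ hτ x y (lx ▸ b0 l) (ly ▸ b0 k) u
  have s1 : ∀ (l : Fin p) (k : Fin q),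
      τ (LinearMap.mul' K _ (splice K x y (2 * l + 1) (2 * k + 1) (f K n (j' k)))) =
        τ (rot (2 * l + 1) x * rot (2 * k + 1) y) -
          τ (rot (2 * l + 2) x * rot (2 * k + 2) y) := fun l k => by
    rw [hf]
    exact trace_splice_self τ hτ x y (lx ▸ b1 l) (ly ▸ b1 k)
  have s0 : ∀ (l : Fin p) (k : Fin q),
      τ (LinearMap.mul' K _ (splice K x y (2 * l) (2 * k) (e K m (j k)))) =
        τ (rot (2 * l) x * rot (2 * k) y) -
          τ (rot (2 * l + 1) x * rot (2 * k + 1) y) := fun l k => by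
    rw [he]
    exact trace_splice_self τ hτ x y (lx ▸ b0 l) (ly ▸ b0 k)
  -- Only the positive `c̄`-terms are reindexed, by the cyclic successor in both words. This brings
  -- them to the rotations by `2 * l + 2` and `2 * k + 2` and produces the shifted indices.
  have hrot : ∑ l : Fin p, ∑ k with j k ≠ i l,
        bar c (i l) (j k) • τ (rot (2 * l) x * rot (2 * k) y) =
      ∑ l : Fin p, ∑ k with j (finRotate q k) ≠ i (finRotate p l),
        bar c (i (finRotate p l)) (j (finRotate q k)) •
          τ (rot (2 * l + 2) x * rot (2 * k + 2) y) := by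
    rw [← Equiv.sum_comp (finRotate p)]
    refine Finset.sum_congr rfl fun l _ => ?_
    rw [Finset.sum_filter, Finset.sum_filter, ← Equiv.sum_comp (finRotate q)]
    simp only [rot_finRotate lx, rot_finRotate ly]
  have hD := h.apply_word_eq i i' j j'
  rw [← hx, ← hy] at hD
  rw [hD]
  simp only [map_sum, map_add, map_smul, s0, s1]
  simp only [t0, t1, map_sum, map_smul, mul_sub, Finset.mul_sum, map_sub,
    mul_smul_comm, smul_sub, Finset.sum_sub_distrib, Finset.sum_add_distrib]
  rw [hrot]
  abel

end Letters

/-- The trace `a ↦ tr(a)` as a linear map to the invariants. -/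
def trₗ (K A : Type*) [Field K] [Ring A] [Algebra K A] (N : ℕ) : A →ₗ[K] issRing K A N where
  toFun := tr K N
  map_add' a b := Subtype.ext (map_add (traceₗ K A N) a b)
  map_smul' r a := Subtype.ext (map_smul (traceₗ K A N) r a)

theorem trₗ_mul_comm {K A : Type*} [Field K] [Ring A] [Algebra K A] {N : ℕ} (a b : A) :
    trₗ K A N (a * b) = trₗ K A N (b * a) :=
  Subtype.ext (traceₗ_mul_comm a b)

end DoublePoisson

end

theorem mainTheorem8 {K : Type*} [Field K] [IsAlgClosed K] [CharZero K] (n m N : ℕ)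
    (c : Fin n → Fin n → K) (d : Fin m → Fin m → K)
    (hc : DoublePoisson.IsDoublePoissonTensor c) (hd : DoublePoisson.IsDoublePoissonTensor d) :
    (∃! D : DoublePoisson.BilinearToTensor K (DoublePoisson.FreeProd K n m),
      DoublePoisson.IsInducedDoubleBracket c d D) ∧
    ∀ D : DoublePoisson.BilinearToTensor K (DoublePoisson.FreeProd K n m),
      DoublePoisson.IsInducedDoubleBracket c d D →
    -- the double bracket of two words
    (∀ (p q : ℕ) (i : Fin p → Fin n) (i' : Fin p → Fin m)
      (j : Fin q → Fin n) (j' : Fin q → Fin m),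
      let x := DoublePoisson.word K i i'
      let y := DoublePoisson.word K j j'
      D x.prod y.prod =
        ∑ l : Fin p,
          ((∑ k with j' k ≠ i' l, DoublePoisson.bar d (i' l) (j' k) •
              DoublePoisson.splice K x y (2 * l + 1) (2 * k + 1) (DoublePoisson.f K n (j' k))) +
            (∑ k with j k ≠ i l, DoublePoisson.bar c (i l) (j k) •
              DoublePoisson.splice K x y (2 * l) (2 * k) (DoublePoisson.e K m (j k))) +
            (∑ k with j' k = i' l,
              DoublePoisson.splice K x y (2 * l + 1) (2 * k + 1) (DoublePoisson.fBar n d (j' k))) +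
            ∑ k with j k = i l,
              DoublePoisson.splice K x y (2 * l) (2 * k) (DoublePoisson.eBar m c (j k)))) ∧
    -- the induced Poisson brackets on the representation space and on its quotient
    (∃! B : DoublePoisson.RepRing K (DoublePoisson.FreeProd K n m) N →ₗ[K]
        DoublePoisson.RepRing K (DoublePoisson.FreeProd K n m) N →ₗ[K]
        DoublePoisson.RepRing K (DoublePoisson.FreeProd K n m) N,
      DoublePoisson.IsInducedOnRep D B) ∧
    ∀ B : DoublePoisson.RepRing K (DoublePoisson.FreeProd K n m) N →ₗ[K]
        DoublePoisson.RepRing K (DoublePoisson.FreeProd K n m) N →ₗ[K]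
        DoublePoisson.RepRing K (DoublePoisson.FreeProd K n m) N,
      DoublePoisson.IsInducedOnRep D B →
    (∃! B' : DoublePoisson.issRing K (DoublePoisson.FreeProd K n m) N →ₗ[K]
        DoublePoisson.issRing K (DoublePoisson.FreeProd K n m) N →ₗ[K]
        DoublePoisson.issRing K (DoublePoisson.FreeProd K n m) N,
      DoublePoisson.IsRestrictionToIss B B') ∧
    ∀ B' : DoublePoisson.issRing K (DoublePoisson.FreeProd K n m) N →ₗ[K]
        DoublePoisson.issRing K (DoublePoisson.FreeProd K n m) N →ₗ[K]
        DoublePoisson.issRing K (DoublePoisson.FreeProd K n m) N,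
      DoublePoisson.IsRestrictionToIss B B' →
    ∀ (p q : ℕ) (i : Fin p → Fin n) (i' : Fin p → Fin m)
      (j : Fin q → Fin n) (j' : Fin q → Fin m),
      let tr := DoublePoisson.tr K (A := DoublePoisson.FreeProd K n m) N
      let σ := DoublePoisson.rot (A := DoublePoisson.FreeProd K n m)
      let x := DoublePoisson.word K i i'
      let y := DoublePoisson.word K j j'
      -- `y` with its letter `f_{j'_k}` replaced by `f̄_{j'_k}`
      let yr := fun k : Fin q => y.set (2 * (k : ℕ) + 1) (DoublePoisson.fBar n d (j' k))
      -- `y` with its letter `e_{j_k}` replaced by `ē_{j_k}`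
      let yl := fun k : Fin q => y.set (2 * (k : ℕ)) (DoublePoisson.eBar m c (j k))
      -- indices start at `0`: the position `l : Fin p` is the `(l + 1)`-st one, and
      -- `finRotate` is the cyclic successor on positions
      B' (tr x.prod) (tr y.prod) =
        ∑ l : Fin p,
          (tr (σ (2 * l + 1) x *
              ((∑ k with j' k ≠ i' l, DoublePoisson.bar d (i' l) (j' k) • σ (2 * k + 1) y) -
                ∑ k with j k ≠ i l, DoublePoisson.bar c (i l) (j k) • σ (2 * k + 1) y)) -
            tr (σ (2 * l + 2) x *
              ((∑ k with j' k ≠ i' l, DoublePoisson.bar d (i' l) (j' k) • σ (2 * k + 2) y) -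
                ∑ k with j (finRotate q k) ≠ i (finRotate p l),
                  DoublePoisson.bar c (i (finRotate p l)) (j (finRotate q k)) •
                    σ (2 * k + 2) y)) +
            (∑ k with j' k = i' l,
              (tr (σ (2 * l + 1) x * σ (2 * k + 1) (yr k)) -
                tr (σ (2 * l + 2) x * σ (2 * k + 2) (yr k)))) +
            ∑ k with j k = i l,
              (tr (σ (2 * l) x * σ (2 * k) (yl k)) -
                tr (σ (2 * l + 1) x * σ (2 * k + 1) (yl k)))) := by
  refine ⟨?_, fun D hD => ⟨fun p q i i' j j' => hD.apply_word_eq i i' j j', ?_, fun B hB =>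
    ⟨hB.existsUnique_restriction, fun B' hB' p q i i' j j' => ?_⟩⟩⟩
  · obtain ⟨D, hD⟩ := DoublePoisson.exists_isInducedDoubleBracket hc hd
    exact ⟨D, hD, fun D' hD' => hD'.unique hD⟩
  · obtain ⟨B, hB⟩ := DoublePoisson.exists_isInducedOnRep (N := N) hD.poisson
    exact ⟨B, hB, fun B' hB' => hB'.unique hB⟩
  -- The bracket on invariants is computed in the full coordinate ring, where the trace identity is
  -- available.
  · have h : ∀ a b, B' (DoublePoisson.tr K N a) (DoublePoisson.tr K N b) =
        DoublePoisson.trₗ K _ N (LinearMap.mul' K _ (D a b)) := fun a b =>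
      Subtype.ext ((hB'.restrict _ _).trans (hB.bracket_traceₗ a b))
    exact (h _ _).trans (hD.trace_apply_word (DoublePoisson.trₗ K _ N)
      DoublePoisson.trₗ_mul_comm i i' j j' _ _ rfl rfl)
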